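/- A *1-periodic graph* is a graph $G$ (loops and multiple edges allowed, no isolated vertices), with a sign $\sigma_e=\pm1$ on every edge $e$, together with a free action of the infinite cyclic group $\langle x\rangle$ by sign-preserving automorphisms whose quotient graph $\overline G$ is finite. Choose a representative $v_{1,0},\dots,v_{n,0}$ of each vertex orbit and put $v_{i,k}=x^k v_{i,0}$. The *Laplacian matrix* of $G$ is the $n\times n$ matrix $L_G=\delta-A$ over $\mathbb Z[x,x^{-1}]$, where $\delta$ is the diagonal matrix whose entry $\delta_{i,i}$ is the sum of the signs of the edges incident to $v_{i,0}$ (loops counted twice), and $A_{i,j}$ is the sum of the monomials $\sigma_e x^{k}$ over all edges $e$ joining $v_{i,0}$ to $v_{j,k}$, $k\in\mathbb Z$ (a loop of $\overline G$ contributes two diagonal terms with inverse monomials). The *Laplacian polynomial* is $\Delta_G=\det L_G\in\mathbb Z[x,x^{-1}]$. $G$ is *plane* if it is embedded in an infinite strip $I\times\mathbb R\subset\mathbb R^2$ on which $x$ acts by a translation along the strip, so that $\overline G$ is embedded in an annulus. The *medial construction* associates with such a $G$ a diagram $D$ of a (possibly infinite) link $\ell$: every edge of $G$ is replaced by two segments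 that run parallel to it, one on each side, except that they cross in its middle, the sign of the edge determining which of the two is the overcrossing strand; near the vertices the segments are joined without further crossings. A component of $\ell$ is *closed* if it is a simple closed curve (and not a line). A *2-coloring* of $D$ is an assignment of elements of $\mathbb Z/2$ to the arcs of $D$ such that at each crossing twice the color of the overcrossing arc equals the sum of the colors of the two undercrossing arcs; the 2-colorings form a group under arc-wise addition. **Proposition.** Let $G$ be a plane 1-periodic graph, $D$ its associated link diagram and $\ell$ the associated link. The following are equivalent. 1. The link $\ell$ has closed components (that is, at least one). 2. The group of 2-colorings of $D$ is infinite. 3. The Laplacian polynomial $\Delta_G$ reduced modulo $2$ is identically zero. -/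

import Mathlib

/-- A signed 1-periodic graph `G` with vertex set `V`, described by its set `D` of darts (edges with
a chosen direction): every edge of `G` is a pair `{d, rev d}`, and the dart `d` runs from `tail d`
to `tail (rev d)`. Loops and multiple edges are allowed, isolated vertices are not.
The generator `x` of the infinite cyclic group acts by `shiftV` and `shiftD`. The action on the
vertices is free; then it is free on darts and on edges as well, since `shiftD ^ n` sending `d` to
`d` or to `rev d` makes `shiftV ^ (2 * n)` fix `tail d`. The quotient graph is finite. -/
structure PeriodicGraph (V D : Type*) where
  tail : D → V
  rev : Equiv.Perm D
  rev_rev : ∀ d, rev (rev d) = d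
  rev_ne : ∀ d, rev d ≠ d
  no_isolated : Function.Surjective tail
  sign : D → ℤˣ
  sign_rev : ∀ d, sign (rev d) = sign d
  shiftV : Equiv.Perm V
  shiftD : Equiv.Perm D
  tail_shift : ∀ d, tail (shiftD d) = shiftV (tail d)
  rev_shift : ∀ d, rev (shiftD d) = shiftD (rev d)
  sign_shift : ∀ d, sign (shiftD d) = sign d
  free : ∀ (n : ℤ) (v : V), (shiftV ^ n) v = v → n = 0
  finite_vertexOrbits : Finite (Quotient (Equiv.Perm.SameCycle.setoid shiftV))
  finite_dartOrbits : Finite (Quotient (Equiv.Perm.SameCycle.setoid shiftD))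

namespace PeriodicGraph

variable {V D : Type*} (G : PeriodicGraph V D)

/-- Vertices of the quotient graph: orbits of vertices under the cyclic group. -/
abbrev VertexOrbit : Type _ := Quotient (Equiv.Perm.SameCycle.setoid G.shiftV)

/-- Darts of the quotient graph: orbits of darts under the cyclic group. -/
abbrev DartOrbit : Type _ := Quotient (Equiv.Perm.SameCycle.setoid G.shiftD)

instance : Finite G.VertexOrbit := G.finite_vertexOrbits

instance : Finite G.DartOrbit := G.finite_dartOrbits

noncomputable instance : Fintype G.VertexOrbit := Fintype.ofFinite _

noncomputable instance : Fintype G.DartOrbit := Fintype.ofFinite _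

/-- The orbit `i` of a vertex `v`. -/
def vertexOrbit (v : V) : G.VertexOrbit := Quotient.mk _ v

theorem exists_level (v : V) :
    ∃ n : ℤ, (G.shiftV ^ n) (Quotient.out (G.vertexOrbit v)) = v :=
  Quotient.mk_out (s := Equiv.Perm.SameCycle.setoid G.shiftV) v

/-- With one chosen vertex `v_{i,0}` in every orbit `i`, every vertex is
`v_{i,n} = x ^ n • v_{i,0}` for a unique `n`, its level. -/
noncomputable def level (v : V) : ℤ := (G.exists_level v).choose

/-- For a dart from `v_{i,m}` to `v_{j,m+n}` (so that a translate of it runs from `v_{i,0}` to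
`v_{j,n}`), this is `n`. -/
noncomputable def voltage (d : D) : ℤ := G.level (G.tail (G.rev d)) - G.level (G.tail d)

open Classical in
/-- The adjacency matrix over `ℤ[x, x⁻¹]`: its entry `(i, j)` is the sum of `sign e * x ^ n` over
the edges `e` of the quotient graph that lift to an edge joining `v_{i,0}` to `v_{j,n}`. Both darts
of an edge are counted, so that a loop of the quotient graph contributes the two diagonal terms
`sign e * x ^ n` and `sign e * x ^ (-n)`. -/
noncomputable def adjacency : Matrix G.VertexOrbit G.VertexOrbit (LaurentPolynomial ℤ) :=
  fun i j => ∑ q : G.DartOrbit,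
    if G.vertexOrbit (G.tail q.out) = i ∧ G.vertexOrbit (G.tail (G.rev q.out)) = j then
      LaurentPolynomial.C ((G.sign q.out : ℤˣ) : ℤ) * LaurentPolynomial.T (G.voltage q.out)
    else 0

open Classical in
/-- The signed degree of a vertex: the sum of the signs of the incident edges, loops twice. -/
noncomputable def signedDegree (i : G.VertexOrbit) : ℤ :=
  ∑ q : G.DartOrbit, if G.vertexOrbit (G.tail q.out) = i then ((G.sign q.out : ℤˣ) : ℤ) else 0

open Classical in
/-- The Laplacian matrix: signed degree matrix minus adjacency matrix. -/
noncomputable def laplacian : Matrix G.VertexOrbit G.VertexOrbit (LaurentPolynomial ℤ) :=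
  Matrix.diagonal (fun i => LaurentPolynomial.C (G.signedDegree i)) - G.adjacency

open Classical in
/-- The Laplacian polynomial. It does not depend on the choice of the vertices `v_{i,0}`, as another
choice conjugates the Laplacian matrix by a diagonal matrix of monomials. -/
noncomputable def laplacianPolynomial : LaurentPolynomial ℤ := G.laplacian.det

end PeriodicGraph

/-- A plane 1-periodic graph: a 1-periodic graph drawn in an infinite strip on which `x` acts as a
translation, so that the finite quotient graph is drawn in the annulus. The drawing is recorded by
its rotation system: `rot d` is the dart that follows `d` in counterclockwise order around
`tail d`. The face permutation `d ↦ rot (rev d)` follows the boundary of the face on the right of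
`d`, up to the turn at the end of each dart.

`euler` is Euler's formula `#V - #E + #F = 2 * #components` for the quotient graph; every connected
component has `#V - #E + #F ≤ 2`, so it says that every component is drawn on a sphere. The annulus
is the sphere with two punctures, and the strip is its infinite cyclic cover. A boundary walk in the
quotient therefore winds around the annulus `0` times, except, if the two punctures lie in different
faces of a component, for the boundary walk of the one face (winding number `1`) and that of the other
(winding number `-1`). The last three fields express this in the cover. -/
structure PlanePeriodicGraph (V D : Type*) extends PeriodicGraph V D where
  rot : Equiv.Perm D
  tail_eq_iff : ∀ d e, tail d = tail e ↔ rot.SameCycle d e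
  rot_shift : ∀ d, rot (shiftD d) = shiftD (rot d)
  euler :
    Nat.card (Quotient (Equiv.Perm.SameCycle.setoid shiftV)) +
      Nat.card (MulAction.orbitRel.Quotient (Subgroup.closure {shiftD, rot * rev}) D) =
    Nat.card (MulAction.orbitRel.Quotient (Subgroup.closure {shiftD, rev}) D) +
      2 * Nat.card (MulAction.orbitRel.Quotient (Subgroup.closure {shiftD, rot, rev}) D)
  winding : ∀ d, ∃ k : ℕ, 0 < k ∧
    (((rot * rev) ^ k) d = d ∨ ((rot * rev) ^ k) d = shiftD d ∨
      ((rot * rev) ^ k) d = shiftD.symm d)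
  upward_unique : ∀ d e, d ∈ MulAction.orbit (Subgroup.closure {rot, rev}) e →
    (∃ k : ℕ, 0 < k ∧ ((rot * rev) ^ k) d = shiftD d) →
    (∃ k : ℕ, 0 < k ∧ ((rot * rev) ^ k) e = shiftD e) → (rot * rev).SameCycle d e
  downward_unique : ∀ d e, d ∈ MulAction.orbit (Subgroup.closure {rot, rev}) e →
    (∃ k : ℕ, 0 < k ∧ ((rot * rev) ^ k) d = shiftD.symm d) →
    (∃ k : ℕ, 0 < k ∧ ((rot * rev) ^ k) e = shiftD.symm e) → (rot * rev).SameCycle d e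

/-- A (possibly infinite) link diagram, without components free of crossings, described by the set
`H` of half-edges of its underlying 4-valent graph. Around a crossing the four half-edges follow
each other counterclockwise under `next`; the edges are the pairs `{h, mate h}`; and `isOver h` tells
whether `h` belongs to the overcrossing strand of its crossing. The strand that arrives at a crossing
along `h` leaves it along the opposite half-edge `next (next h)`. -/
structure LinkDiagram (H : Type*) where
  next : Equiv.Perm H
  next_four : ∀ h, next (next (next (next h))) = h
  next_two_ne : ∀ h, next (next h) ≠ h
  mate : Equiv.Perm H
  mate_mate : ∀ h, mate (mate h) = h
  mate_ne : ∀ h, mate h ≠ h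
  isOver : H → Prop
  isOver_next : ∀ h, isOver (next h) ↔ ¬ isOver h

namespace LinkDiagram

variable {H : Type*} (L : LinkDiagram H)

/-- The arcs of the diagram, as sets of half-edges: an arc continues along edges and through
crossings where it lies on the overcrossing strand, and it breaks at its undercrossings. -/
def Arc : Type _ := Quot fun h h₁ : H => h₁ = L.mate h ∨ (L.isOver h ∧ h₁ = L.next (L.next h))

/-- The arc to which a half-edge belongs. -/
def arc (h : H) : L.Arc := Quot.mk _ h

/-- The components of the link, as sets of half-edges: a component continues along edges and
straight through all crossings. -/
def Component : Type _ := Quot fun h h₁ : H => h₁ = L.mate h ∨ h₁ = L.next (L.next h)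

/-- The component to which a half-edge belongs. -/
def component (h : H) : L.Component := Quot.mk _ h

/-- One step of the journey along a component: leave a crossing along `h`, arrive at the next
crossing along `mate h`, and pass straight through it. -/
def step (h : H) : H := L.next (L.next (L.mate h))

variable {L} in
/-- A component is closed (a simple closed curve, and not a line) if the journey along it returns to
a half-edge that it started from. -/
def Component.IsClosed (K : L.Component) : Prop :=
  ∃ h : H, L.component h = K ∧ ∃ k : ℕ, 0 < k ∧ L.step^[k] h = h

/-- The group of Fox colorings of the diagram by elements of an abelian group `A`: at every crossing,
twice the color of the overcrossing arc is the sum of the colors of the undercrossing arcs. For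
`A = ZMod p` these are the Fox `p`-colorings. -/
def colorings (A : Type*) [AddCommGroup A] : AddSubgroup (L.Arc → A) where
  carrier := {c | ∀ h, L.isOver h →
    2 • c (L.arc h) = c (L.arc (L.next h)) + c (L.arc (L.next.symm h))}
  zero_mem' := by intro h _; simp
  add_mem' := by
    intro a b ha hb h ho
    simp only [Pi.add_apply, smul_add, ha h ho, hb h ho]
    abel
  neg_mem' := by
    intro a ha h ho
    simp only [Pi.neg_apply, smul_neg, ha h ho]
    abel

end LinkDiagram

namespace PlanePeriodicGraph

variable {V D : Type*} (G : PlanePeriodicGraph V D)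

/-- The link diagram associated with `G` by the medial construction. Every edge of `G` is replaced by
two segments that run parallel to it and cross in its middle. The half-edges at that crossing are
`(d, true)` and `(d, false)`, for the two darts `d` of the edge: the halves near `tail d`, on the left
and on the right of `d`. In counterclockwise order they are
`(d, true)`, `(d, false)`, `(rev d, true)`, `(rev d, false)`.
Near a vertex, the segment on the left of `d` is joined to the one on the right of `rot d`.
The sign of the edge tells which of the two strands is the overcrossing one. -/
def medialDiagram : LinkDiagram (D × Bool) where
  next :=
    { toFun := fun h => if h.2 then (h.1, false) else (G.rev h.1, true)
      invFun := fun h => if h.2 then (G.rev h.1, false) else (h.1, true)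
      left_inv := by rintro ⟨d, _ | _⟩ <;> simp [G.rev_rev]
      right_inv := by rintro ⟨d, _ | _⟩ <;> simp [G.rev_rev] }
  next_four := by rintro ⟨d, _ | _⟩ <;> simp [G.rev_rev]
  next_two_ne := by rintro ⟨d, _ | _⟩ <;> simp [G.rev_ne]
  mate :=
    { toFun := fun h => if h.2 then (G.rot h.1, false) else (G.rot.symm h.1, true)
      invFun := fun h => if h.2 then (G.rot h.1, false) else (G.rot.symm h.1, true)
      left_inv := by rintro ⟨d, _ | _⟩ <;> simp
      right_inv := by rintro ⟨d, _ | _⟩ <;> simp }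
  mate_mate := by rintro ⟨d, _ | _⟩ <;> simp
  mate_ne := by rintro ⟨d, _ | _⟩ <;> simp
  isOver := fun h => if h.2 then G.sign h.1 = 1 else G.sign h.1 = -1
  isOver_next := by
    rintro ⟨d, _ | _⟩ <;> rcases Int.units_eq_one_or (G.sign d) with h | h <;>
      simp [G.sign_rev, h]

end PlanePeriodicGraph

/-! Modulo 2 the coloring condition only says that the two undercrossing arcs at a crossing have
equal colors. So a 2-coloring is a function constant on link components, and the signs play no role.
If every component is a line, each is carried to itself by a nonzero translation
(`exists_shift_component_eq`), so there are finitely many components and colorings: 2 → 1.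

The other implications use the `N`-fold cyclic covers of the quotient graph, finite maps on
`DartOrbit × ZMod N`. An edge of the medial diagram passes through a corner, between a vertex and a
face. Writing its color as the sum of a vertex function `f` and a face function `g`, the crossing
condition becomes equality of the coboundaries of `f` and `g`. When all components of the map are
spheres, a vertex function `f` has such a partner `g` exactly when it is harmonic mod 2. Hence
colorings and harmonic functions have equal dimension (`finrank_medialColorings_eq`). Planarity
enters through Euler's inequality for the covers (`euler_cover`).

A closed component gives at least `N` colorings of the `N`-fold cover (`le_card_medialColorings`),
while a nonzero determinant mod 2 bounds the harmonic functions uniformly in `N`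
(`finite_laplaceKernel`, `card_laplaceKernel_zmod_le`): 1 → 3. A zero determinant makes their number
unbounded (`exists_card_laplaceKernel_gt`), and colorings of the covers pull back to the infinite
diagram (`card_medialColorings_le`): 3 → 2. -/

/-! ### Colorings and harmonic functions on a finite spherical map. -/

section FiniteMap

variable {X : Type*}

/-- The functions to `ZMod 2` that are invariant under every permutation in `T`. -/
def invariantFunctions (T : Set (Equiv.Perm X)) : Submodule (ZMod 2) (X → ZMod 2) where
  carrier := {f | ∀ σ ∈ T, ∀ x, f (σ x) = f x}
  zero_mem' := by intro σ _ x; rfl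
  add_mem' := by
    intro f g hf hg σ hσ x
    simp only [Pi.add_apply, hf σ hσ, hg σ hσ]
  smul_mem' := by
    intro c f hf σ hσ x
    simp only [Pi.smul_apply, hf σ hσ]

theorem mem_invariantFunctions_singleton {σ : Equiv.Perm X} {f : X → ZMod 2} :
    f ∈ invariantFunctions {σ} ↔ ∀ x, f (σ x) = f x := by
  simp [invariantFunctions]

theorem mem_invariantFunctions_pair {σ τ : Equiv.Perm X} {f : X → ZMod 2} :
    f ∈ invariantFunctions {σ, τ} ↔ (∀ x, f (σ x) = f x) ∧ ∀ x, f (τ x) = f x := by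
  simp [invariantFunctions]

/-- The coboundary `g ↦ g + g ∘ σ`. -/
def coboundary (σ : Equiv.Perm X) : (X → ZMod 2) →ₗ[ZMod 2] (X → ZMod 2) where
  toFun g := fun x => g x + g (σ x)
  map_add' f g := by ext x; simp only [Pi.add_apply]; ring
  map_smul' c f := by ext x; simp only [Pi.smul_apply, smul_eq_mul, RingHom.id_apply]; ring

@[simp] theorem coboundary_apply (σ : Equiv.Perm X) (g : X → ZMod 2) (x : X) :
    coboundary σ g x = g x + g (σ x) := rfl

theorem ker_coboundary (σ : Equiv.Perm X) :
    LinearMap.ker (coboundary σ) = invariantFunctions {σ} := by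
  ext f
  rw [LinearMap.mem_ker, mem_invariantFunctions_singleton, funext_iff]
  refine forall_congr' fun x => ?_
  rw [coboundary_apply, Pi.zero_apply, CharTwo.add_eq_zero, eq_comm]

/-- The coloring defined by a pair of potentials. -/
def pairColoring (rev : Equiv.Perm X) : ((X → ZMod 2) × (X → ZMod 2)) →ₗ[ZMod 2] (X → ZMod 2) :=
  LinearMap.fst _ _ _ + (LinearMap.funLeft _ _ rev).comp (LinearMap.snd _ _ _)

@[simp] theorem pairColoring_apply (rev : Equiv.Perm X) (p : (X → ZMod 2) × (X → ZMod 2)) (x : X) :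
    pairColoring rev p x = p.1 x + p.2 (rev x) := rfl

variable [Fintype X]

/-- The dot product on functions to `ZMod 2`. -/
def dotForm (X : Type*) [Fintype X] : LinearMap.BilinForm (ZMod 2) (X → ZMod 2) :=
  dotProductBilin (ZMod 2) (ZMod 2)

theorem dotForm_apply (f g : X → ZMod 2) : dotForm X f g = ∑ x, f x * g x := rfl

theorem dotForm_nondegenerate : (dotForm X).Nondegenerate := by
  classical
  constructor
  · intro f hf
    ext x
    simpa [dotForm_apply, Pi.single_apply] using hf (Pi.single x 1)
  · intro f hf
    ext x
    simpa [dotForm_apply, Pi.single_apply] using hf (Pi.single x 1)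

theorem dotForm_comp_perm (f g : X → ZMod 2) (σ : Equiv.Perm X) (hg : ∀ x, g (σ x) = g x) :
    ∑ x, f (σ x) * g x = ∑ x, f x * g x := by
  rw [← Equiv.sum_comp σ (fun x => f x * g x)]
  simp only [hg]

theorem dotForm_coboundary_eq_zero (f g : X → ZMod 2) (σ : Equiv.Perm X)
    (hg : ∀ x, g (σ x) = g x) : ∑ x, coboundary σ f x * g x = 0 := by
  simp only [coboundary_apply, add_mul, Finset.sum_add_distrib, dotForm_comp_perm f g σ hg]
  exact CharTwo.add_self_eq_zero _

theorem sum_eq_zero_of_involution (f : X → ZMod 2) (σ : Equiv.Perm X) (h2 : ∀ x, σ (σ x) = x)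
    (hne : ∀ x, σ x ≠ x) (hf : ∀ x, f (σ x) = f x) : ∑ x, f x = 0 :=
  Finset.sum_involution (fun x _ => σ x)
    (fun x _ => by rw [hf]; exact CharTwo.add_self_eq_zero _) (fun x _ _ => hne x)
    (fun _ _ => Finset.mem_univ _) (fun x _ => h2 x)

/-- For an involution the range of the coboundary lies in its kernel; rank-nullity does the rest. -/
theorem card_le_two_mul_finrank_invariantFunctions (σ : Equiv.Perm X) (h2 : ∀ x, σ (σ x) = x) :
    Fintype.card X ≤ 2 * Module.finrank (ZMod 2) (invariantFunctions {σ}) := by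
  have h := LinearMap.finrank_range_add_finrank_ker (coboundary σ)
  have hr : LinearMap.range (coboundary σ) ≤ invariantFunctions {σ} := by
    rintro _ ⟨g, rfl⟩
    rw [mem_invariantFunctions_singleton]
    intro x
    rw [coboundary_apply, coboundary_apply, h2, add_comm]
  have := Submodule.finrank_mono hr
  rw [ker_coboundary, Module.finrank_fintype_fun_eq_card] at h
  omega

variable (rot rev : Equiv.Perm X)

/-- For a map on the sphere, every mod 2 cochain on the edges that is closed around the vertices is
the coboundary of a cochain on the faces. -/
theorem exists_face_potential (h2 : ∀ x, rev (rev x) = x) (hne : ∀ x, rev x ≠ x)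
    (heuler : Module.finrank (ZMod 2) (invariantFunctions {rev}) +
        2 * Module.finrank (ZMod 2) (invariantFunctions {rot, rev}) ≤
      Module.finrank (ZMod 2) (invariantFunctions {rot}) +
        Module.finrank (ZMod 2) (invariantFunctions {rot * rev}))
    (η : X → ZMod 2) (hη : ∀ x, η (rev x) = η x)
    (hη' : ∀ f ∈ invariantFunctions {rot}, ∑ x, η x * f x = 0) :
    ∃ g ∈ invariantFunctions {rot * rev}, coboundary rev g = η := by
  set E := invariantFunctions {rev}
  set W := invariantFunctions {rot}
  set F := invariantFunctions {rot * rev}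
  set C := invariantFunctions {rot, rev}
  have hEW : E ⊓ W = C := by
    ext f
    simp only [Submodule.mem_inf, E, W, C, mem_invariantFunctions_singleton,
      mem_invariantFunctions_pair, and_comm]
  -- A face function invariant under `rev` is invariant under `rot` too, hence constant on
  -- components.
  have hker : Module.finrank (ZMod 2) (LinearMap.ker ((coboundary rev).domRestrict F)) ≤
      Module.finrank (ZMod 2) C := by
    rw [LinearMap.ker_domRestrict, ← Submodule.finrank_map_subtype_eq F]
    refine Submodule.finrank_mono ?_
    rintro _ ⟨⟨f, hf⟩, hf', rfl⟩
    have hf' : f ∈ LinearMap.ker (coboundary rev) := hf'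
    rw [ker_coboundary, mem_invariantFunctions_singleton] at hf'
    rw [mem_invariantFunctions_singleton] at hf
    refine mem_invariantFunctions_pair.2 ⟨fun x => ?_, hf'⟩
    have := hf (rev x)
    simpa [h2, hf'] using this
  have hsum := Submodule.finrank_sup_add_finrank_inf_eq E W
  have horth := LinearMap.BilinForm.finrank_orthogonal (dotForm_nondegenerate (X := X)) (E ⊔ W)
  have hcard : _ ≤ 2 * Module.finrank (ZMod 2) E :=
    card_le_two_mul_finrank_invariantFunctions rev h2
  have hrange := LinearMap.finrank_range_add_finrank_ker ((coboundary rev).domRestrict F)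
  rw [Module.finrank_fintype_fun_eq_card] at horth
  have hmem : ∀ ζ : X → ZMod 2, (∀ e ∈ E, ∑ x, e x * ζ x = 0) → (∀ f ∈ W, ∑ x, f x * ζ x = 0) →
      ζ ∈ (dotForm X).orthogonal (E ⊔ W) := by
    intro ζ h1 h2 u hu
    obtain ⟨e, he, f, hf, rfl⟩ := Submodule.mem_sup.1 hu
    change dotForm X (e + f) ζ = 0
    rw [map_add, LinearMap.add_apply, dotForm_apply, dotForm_apply, h1 e he, h2 f hf, add_zero]
  have hle : LinearMap.range ((coboundary rev).domRestrict F) ≤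
      (dotForm X).orthogonal (E ⊔ W) := by
    rintro _ ⟨⟨g, hg⟩, rfl⟩
    rw [mem_invariantFunctions_singleton] at hg
    -- The faces on the two sides of a dart are also compared by `rot`, so the coboundary is
    -- orthogonal to vertex functions as well as to edge functions.
    have hg' : (coboundary rev) g = coboundary rot g := by
      ext x
      have := hg (rev x)
      simp only [Equiv.Perm.mul_apply, h2] at this
      simp [this]
    refine hmem _ (fun e he => ?_) (fun f hf => ?_)
    · simp only [mul_comm (e _)]
      exact dotForm_coboundary_eq_zero g e rev (mem_invariantFunctions_singleton.1 he)
    · simp only [mul_comm (f _), LinearMap.domRestrict_apply, hg']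
      exact dotForm_coboundary_eq_zero g f rot (mem_invariantFunctions_singleton.1 hf)
  -- The orthogonal complement has dimension at most `dim E - dim W + dim C`, the range at least
  -- `dim F - dim C`; Euler's inequality puts the first below the second.
  have heq := Submodule.eq_of_le_of_finrank_le hle (by rw [hEW] at hsum; omega)
  have hηmem : η ∈ (dotForm X).orthogonal (E ⊔ W) := by
    refine hmem _ (fun e he => ?_) (fun f hf => ?_)
    · exact sum_eq_zero_of_involution _ rev h2 hne
        (fun x => by rw [hη, mem_invariantFunctions_singleton.1 he])
    · simpa only [mul_comm (f _)] using hη' f hf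
  rw [← heq] at hηmem
  obtain ⟨⟨g, hg⟩, rfl⟩ := hηmem
  exact ⟨g, hg, rfl⟩

/-- Mod 2 colorings of the medial diagram: `c x` is the color of the strand on the left of `x`,
and `c (rot⁻¹ x)` that of the strand on the right. -/
def medialColorings : Submodule (ZMod 2) (X → ZMod 2) where
  carrier := {c | (∀ x, c (rev x) = c x) ∧ ∀ x, c (rot.symm (rev x)) = c (rot.symm x)}
  zero_mem' := ⟨fun _ => rfl, fun _ => rfl⟩
  add_mem' := by
    intro f g hf hg
    exact ⟨fun x => by simp only [Pi.add_apply, hf.1, hg.1],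
      fun x => by simp only [Pi.add_apply, hf.2, hg.2]⟩
  smul_mem' := by
    intro c f hf
    exact ⟨fun x => by simp only [Pi.smul_apply, hf.1], fun x => by simp only [Pi.smul_apply, hf.2]⟩

/-- The kernel of the mod 2 Laplacian on functions on the vertices. -/
def harmonicFunctions : Submodule (ZMod 2) (X → ZMod 2) where
  carrier := {f | f ∈ invariantFunctions {rot} ∧
    ∀ w ∈ invariantFunctions {rot}, ∑ x, coboundary rev f x * w x = 0}
  zero_mem' := ⟨Submodule.zero_mem _, fun w _ => by simp⟩
  add_mem' := by
    intro f g hf hg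
    refine ⟨Submodule.add_mem _ hf.1 hg.1, fun w hw => ?_⟩
    rw [map_add]
    simp only [Pi.add_apply, add_mul, Finset.sum_add_distrib]
    rw [hf.2 w hw, hg.2 w hw, add_zero]
  smul_mem' := by
    intro c f hf
    refine ⟨Submodule.smul_mem _ c hf.1, fun w hw => ?_⟩
    rw [map_smul]
    simp only [Pi.smul_apply, smul_eq_mul, mul_assoc, ← Finset.mul_sum]
    rw [hf.2 w hw, mul_zero]

/-- Pairs of a function on the vertices and a function on the faces with the same coboundary. -/
def potentialPairs : Submodule (ZMod 2) ((X → ZMod 2) × (X → ZMod 2)) where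
  carrier := {p | p.1 ∈ invariantFunctions {rot} ∧ p.2 ∈ invariantFunctions {rot * rev} ∧
    coboundary rev p.1 = coboundary rev p.2}
  zero_mem' := ⟨Submodule.zero_mem _, Submodule.zero_mem _, rfl⟩
  add_mem' := by
    intro p q hp hq
    refine ⟨Submodule.add_mem _ hp.1 hq.1, Submodule.add_mem _ hp.2.1 hq.2.1, ?_⟩
    rw [Prod.fst_add, Prod.snd_add, map_add, map_add, hp.2.2, hq.2.2]
  smul_mem' := by
    intro c p hp
    refine ⟨Submodule.smul_mem _ c hp.1, Submodule.smul_mem _ c hp.2.1, ?_⟩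
    rw [Prod.smul_fst, Prod.smul_snd, map_smul, map_smul, hp.2.2]

/-- Both spaces are images of `potentialPairs`, under the first projection and under `pairColoring`.
The kernels consist of the pairs `(0, g)` and `(g, g)` with `g` constant on components, so they are
isomorphic. -/
theorem finrank_medialColorings_eq (h2 : ∀ x, rev (rev x) = x) (hne : ∀ x, rev x ≠ x)
    (heuler : Module.finrank (ZMod 2) (invariantFunctions {rev}) +
        2 * Module.finrank (ZMod 2) (invariantFunctions {rot, rev}) ≤
      Module.finrank (ZMod 2) (invariantFunctions {rot}) +
        Module.finrank (ZMod 2) (invariantFunctions {rot * rev})) :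
    Module.finrank (ZMod 2) (medialColorings rot rev) =
      Module.finrank (ZMod 2) (harmonicFunctions rot rev) := by
  set P := potentialPairs rot rev
  -- The value `g x` belongs to the face on the right of `x`, so `g (rev x)` belongs to the one on
  -- the left.
  have hface : ∀ g ∈ invariantFunctions {rot * rev}, ∀ x, g (rev x) = g (rot x) := by
    intro g hg x
    have := mem_invariantFunctions_singleton.1 hg (rev x)
    simpa [h2] using this.symm
  have hswap : ∀ a b c d : ZMod 2, a + b = c + d → a + d = b + c := by decide
  have hswap' : ∀ a b c d : ZMod 2, a + b = c + d → c + b = a + d := by decide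
  have hrange1 : LinearMap.range ((LinearMap.fst (ZMod 2) (X → ZMod 2) (X → ZMod 2)).domRestrict P)
      = harmonicFunctions rot rev := by
    ext f
    constructor
    · rintro ⟨⟨⟨f, g⟩, hf, hg, hfg⟩, rfl⟩
      refine ⟨hf, fun w hw => ?_⟩
      have hg' : coboundary rev g = coboundary rot g := by
        ext x
        simp [hface g hg]
      change ∑ x, coboundary rev f x * w x = 0
      simp only at hfg
      rw [hfg, hg']
      exact dotForm_coboundary_eq_zero g w rot (mem_invariantFunctions_singleton.1 hw)
    · rintro ⟨hf, hf'⟩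
      obtain ⟨g, hg, hfg⟩ := exists_face_potential rot rev h2 hne heuler (coboundary rev f)
        (fun x => by rw [coboundary_apply, coboundary_apply, h2, add_comm]) hf'
      exact ⟨⟨(f, g), hf, hg, hfg.symm⟩, rfl⟩
  have hrange2 : LinearMap.range ((pairColoring rev).domRestrict P) = medialColorings rot rev := by
    ext c
    constructor
    · rintro ⟨⟨⟨f, g⟩, hf, hg, hfg⟩, rfl⟩
      have hfg' : ∀ x, f x + f (rev x) = g x + g (rev x) := fun x => congrFun hfg x
      have hf' : ∀ x, f (rot.symm x) = f x := fun x => by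
        simpa using (mem_invariantFunctions_singleton.1 hf (rot.symm x)).symm
      have hg' : ∀ x, g (rev (rot.symm x)) = g x := fun x => by
        rw [hface g hg, Equiv.apply_symm_apply]
      constructor
      · intro x
        change f (rev x) + g (rev (rev x)) = f x + g (rev x)
        rw [h2]
        exact hswap _ _ _ _ (by rw [add_comm, hfg' x, add_comm])
      · intro x
        change f (rot.symm (rev x)) + g (rev (rot.symm (rev x))) =
          f (rot.symm x) + g (rev (rot.symm x))
        rw [hf', hf', hg', hg']
        exact hswap _ _ _ _ (by rw [add_comm, hfg' x, add_comm])
    · rintro ⟨hc, hc'⟩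
      -- The two strands at the tail of a dart share the vertex term, so the sum of their colors
      -- must be the coboundary of `g`. This determines `g` first, and then `f x = c x + g (rev x)`.
      have key := exists_face_potential rot rev h2 hne heuler (coboundary rot.symm c)
        (fun x => by simp only [coboundary_apply, hc, hc']) (fun w hw =>
          dotForm_coboundary_eq_zero c w rot.symm fun x => by
            rw [← mem_invariantFunctions_singleton.1 hw (rot.symm x), Equiv.apply_symm_apply])
      obtain ⟨g, hg, hgc⟩ := key
      have hgc' : ∀ x, g x + g (rev x) = c x + c (rot.symm x) := fun x => congrFun hgc x
      refine ⟨⟨(fun x => c x + g (rev x), g), ?_, hg, ?_⟩, ?_⟩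
      · rw [mem_invariantFunctions_singleton]
        intro x
        have h1 := hgc' (rot x)
        rw [Equiv.symm_apply_apply] at h1
        change c (rot x) + g (rev (rot x)) = c x + g (rev x)
        rw [hface g hg x, add_comm (c x)]
        exact hswap' _ _ _ _ h1
      · ext x
        simp only [coboundary_apply, hc, h2]
        rw [add_add_add_comm, CharTwo.add_self_eq_zero, zero_add, add_comm]
      · ext x
        change c x + g (rev x) + g (rev x) = c x
        rw [add_assoc, CharTwo.add_self_eq_zero, add_zero]
  have hker : Module.finrank (ZMod 2) (LinearMap.ker
        ((LinearMap.fst (ZMod 2) (X → ZMod 2) (X → ZMod 2)).domRestrict P)) =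
      Module.finrank (ZMod 2) (LinearMap.ker ((pairColoring rev).domRestrict P)) := by
    have hzero : ∀ g : X → ZMod 2, coboundary rev 0 = coboundary rev g →
        ∀ x, g (rev x) = g x := by
      intro g hg x
      have := congrFun hg x
      rw [map_zero, Pi.zero_apply, coboundary_apply, eq_comm, CharTwo.add_eq_zero] at this
      exact this.symm
    have hfst : ∀ p : LinearMap.ker ((pairColoring rev).domRestrict P), ∀ x,
        p.1.1.1 x = p.1.1.2 x := by
      intro p x
      have h1 := congrFun (show pairColoring rev p.1.1 = 0 from p.2) (rot.symm x)
      rw [pairColoring_apply, Pi.zero_apply, CharTwo.add_eq_zero, hface _ p.1.2.2.1,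
        Equiv.apply_symm_apply] at h1
      rw [← h1, ← mem_invariantFunctions_singleton.1 p.1.2.1 (rot.symm x),
        Equiv.apply_symm_apply]
    have hrev : ∀ p : LinearMap.ker ((pairColoring rev).domRestrict P), ∀ x,
        p.1.1.2 (rev x) = p.1.1.2 x := by
      intro p x
      have h1 := congrFun (show pairColoring rev p.1.1 = 0 from p.2) x
      rw [pairColoring_apply, Pi.zero_apply, CharTwo.add_eq_zero, hfst] at h1
      exact h1.symm
    refine LinearEquiv.finrank_eq
      { toFun := fun p => ⟨⟨(p.1.1.2, p.1.1.2), ?_, p.1.2.2.1, rfl⟩, ?_⟩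
        invFun := fun p => ⟨⟨(0, p.1.1.2), Submodule.zero_mem _, p.1.2.2.1, ?_⟩, rfl⟩
        map_add' := fun p q => rfl
        map_smul' := fun c p => rfl
        left_inv := ?_
        right_inv := ?_ }
    · have hp : p.1.1.1 = 0 := p.2
      have := hzero p.1.1.2 (hp ▸ p.1.2.2.2)
      exact mem_invariantFunctions_singleton.2 fun x => by
        change p.1.1.2 (rot x) = p.1.1.2 x
        rw [← hface _ p.1.2.2.1, this]
    · have hp : p.1.1.1 = 0 := p.2
      have := hzero p.1.1.2 (hp ▸ p.1.2.2.2)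
      ext x
      change p.1.1.2 x + p.1.1.2 (rev x) = 0
      rw [this, CharTwo.add_self_eq_zero]
    · rw [map_zero]
      ext x
      rw [Pi.zero_apply, coboundary_apply, hrev p x, CharTwo.add_self_eq_zero]
    · intro p
      have hp : p.1.1.1 = 0 := p.2
      exact Subtype.ext (Subtype.ext (Prod.ext hp.symm rfl))
    · intro p
      exact Subtype.ext (Subtype.ext (Prod.ext (funext fun x => (hfst p x).symm) rfl))
  have h1 := LinearMap.finrank_range_add_finrank_ker
    ((LinearMap.fst (ZMod 2) (X → ZMod 2) (X → ZMod 2)).domRestrict P)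
  have h2' := LinearMap.finrank_range_add_finrank_ker ((pairColoring rev).domRestrict P)
  rw [hrange1] at h1
  rw [hrange2] at h2'
  omega

end FiniteMap

/-! ### Counting orbits after replacing `s` by `s ^ N`. -/

section OrbitCount

variable {D : Type*}

theorem commute_of_mem_closure {s : Equiv.Perm D} {S : Set (Equiv.Perm D)}
    (hS : ∀ σ ∈ S, Commute σ s) {γ : Equiv.Perm D} (hγ : γ ∈ Subgroup.closure S) :
    Commute γ s := by
  induction hγ using Subgroup.closure_induction with
  | mem x hx => exact hS x hx
  | one => exact Commute.one_left s
  | mul x y _ _ hx hy => exact hx.mul_left hy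
  | inv x _ hx => exact hx.inv_left

theorem Equiv.Perm.zpow_apply_comm_of_commute {σ s : Equiv.Perm D} (h : Commute σ s) (m : ℤ)
    (d : D) : σ ((s ^ m) d) = (s ^ m) (σ d) :=
  Equiv.Perm.congr_fun (h.zpow_right m).eq d

/-- Orbits of the group generated by `S` and a permutation commuting with `S`. -/
theorem mem_orbit_closure_insert {s : Equiv.Perm D} {S : Set (Equiv.Perm D)}
    (hS : ∀ σ ∈ S, Commute σ s) {d e : D} :
    e ∈ MulAction.orbit (Subgroup.closure (insert s S)) d ↔
      ∃ m : ℤ, ∃ γ ∈ Subgroup.closure S, e = (s ^ m) (γ d) := by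
  constructor
  · rintro ⟨⟨g, hg⟩, rfl⟩
    change ∃ m : ℤ, ∃ γ ∈ Subgroup.closure S, g d = (s ^ m) (γ d)
    suffices h : ∃ m : ℤ, ∃ γ ∈ Subgroup.closure S, g = s ^ m * γ by
      obtain ⟨m, γ, hγ, rfl⟩ := h
      exact ⟨m, γ, hγ, rfl⟩
    induction hg using Subgroup.closure_induction with
    | mem x hx =>
      rcases hx with rfl | hx
      · exact ⟨1, 1, Subgroup.one_mem _, by simp⟩
      · exact ⟨0, x, Subgroup.subset_closure hx, by simp⟩
    | one => exact ⟨0, 1, Subgroup.one_mem _, by simp⟩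
    | mul x y _ _ hx hy =>
      obtain ⟨m, γ, hγ, rfl⟩ := hx
      obtain ⟨n, δ, hδ, rfl⟩ := hy
      refine ⟨m + n, γ * δ, Subgroup.mul_mem _ hγ hδ, ?_⟩
      have := ((commute_of_mem_closure hS hγ).zpow_right n).eq
      rw [zpow_add, mul_assoc, ← mul_assoc γ, this, mul_assoc, mul_assoc]
    | inv x _ hx =>
      obtain ⟨m, γ, hγ, rfl⟩ := hx
      refine ⟨-m, γ⁻¹, Subgroup.inv_mem _ hγ, ?_⟩
      rw [mul_inv_rev, zpow_neg]
      exact (((commute_of_mem_closure hS hγ).zpow_right m).inv_inv).eq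
  · rintro ⟨m, γ, hγ, rfl⟩
    exact ⟨⟨s ^ m * γ, Subgroup.mul_mem _
      (Subgroup.zpow_mem _ (Subgroup.subset_closure (Set.mem_insert _ _)) m)
      (Subgroup.closure_mono (Set.subset_insert _ _) hγ)⟩, rfl⟩

/-- If `γ` agrees with `s` at `d` and commutes with it, then `γ⁻¹ * s` and all its powers fix `d`.
-/
theorem zpow_mem_orbit_of_mem {s : Equiv.Perm D} {S : Set (Equiv.Perm D)}
    (hS : ∀ σ ∈ S, Commute σ s) {d : D} (h : s d ∈ MulAction.orbit (Subgroup.closure S) d) (m : ℤ) :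
    ∃ γ ∈ Subgroup.closure S, (s ^ m) d = γ d := by
  obtain ⟨⟨γ, hγ⟩, hd⟩ := h
  have hd : γ d = s d := hd
  refine ⟨γ ^ m, Subgroup.zpow_mem _ hγ m, ?_⟩
  have hc := commute_of_mem_closure hS hγ
  have h1 : (γ⁻¹ * s) d = d := by
    rw [Equiv.Perm.mul_apply, ← hd, ← Equiv.Perm.mul_apply, inv_mul_cancel, Equiv.Perm.one_apply]
  have h2 : ((γ⁻¹ * s) ^ m) d = d := Function.IsFixedPt.perm_zpow h1 m
  rw [hc.inv_left.mul_zpow, Equiv.Perm.mul_apply, inv_zpow, Equiv.Perm.inv_eq_iff_eq] at h2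
  exact h2

variable (s : Equiv.Perm D) (S : Set (Equiv.Perm D))

/-- Orbits of the group generated by `S` and `s`. -/
abbrev JointOrbits : Type _ := MulAction.orbitRel.Quotient (Subgroup.closure (insert s S)) D

/-- The joint orbit of `d`. -/
abbrev jointOrbit (d : D) : JointOrbits s S := Quotient.mk _ d

variable {s S}

theorem jointOrbit_eq_iff (hS : ∀ σ ∈ S, Commute σ s) {d e : D} :
    jointOrbit s S e = jointOrbit s S d ↔ ∃ m : ℤ, ∃ γ ∈ Subgroup.closure S, e = (s ^ m) (γ d) := by
  rw [← mem_orbit_closure_insert hS, ← MulAction.orbitRel_apply]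
  exact Quotient.eq

theorem jointOrbit_pow_eq_iff (hS : ∀ σ ∈ S, Commute σ s) (N : ℕ) {d e : D} :
    jointOrbit (s ^ N) S e = jointOrbit (s ^ N) S d ↔
      ∃ m : ℤ, ∃ γ ∈ Subgroup.closure S, e = (s ^ (N * m)) (γ d) := by
  rw [jointOrbit_eq_iff fun σ hσ => (hS σ hσ).pow_right N]
  simp only [zpow_mul, zpow_natCast]

/-- The joint orbits for `s ^ N` over a set `P` of joint orbits for `s`, one for each, and over
its complement, `N` for each. -/
def coverOrbit (N : ℕ) (rep : JointOrbits s S → D) (P : Set (JointOrbits s S)) :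
    P ⊕ ((Pᶜ : Set (JointOrbits s S)) × Fin N) → JointOrbits (s ^ N) S :=
  Sum.elim (fun q => jointOrbit (s ^ N) S (rep q))
    (fun p => jointOrbit (s ^ N) S ((s ^ (p.2 : ℤ)) (rep p.1)))

/-- Every point is `s ^ m` applied to a point of the `S`-orbit of a representative. Over `P` the
factor `s ^ m` is absorbed by `S`; elsewhere only `m` modulo `N` matters. -/
theorem coverOrbit_surjective (hS : ∀ σ ∈ S, Commute σ s) {N : ℕ} (hN : 0 < N)
    (rep : JointOrbits s S → D) (hrep : ∀ q, jointOrbit s S (rep q) = q)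
    (P : Set (JointOrbits s S))
    (hP : ∀ q ∈ P, s (rep q) ∈ MulAction.orbit (Subgroup.closure S) (rep q)) :
    Function.Surjective (coverOrbit N rep P) := by
  rintro ⟨x⟩
  obtain ⟨m, γ, hγ, hx⟩ := (jointOrbit_eq_iff hS).1 (hrep (jointOrbit s S x)).symm
  have hcomm := commute_of_mem_closure hS hγ
  by_cases hq : jointOrbit s S x ∈ P
  · refine ⟨Sum.inl ⟨_, hq⟩, ?_⟩
    obtain ⟨δ, hδ, h⟩ := zpow_mem_orbit_of_mem hS (hP _ hq) m
    refine ((jointOrbit_pow_eq_iff hS N).2 ⟨0, γ * δ, Subgroup.mul_mem _ hγ hδ, ?_⟩).symm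
    refine hx.trans ?_
    rw [← Equiv.Perm.zpow_apply_comm_of_commute hcomm, h]
    simp
  · have hlt : (m % N).toNat < N := by
      have := Int.emod_lt_of_pos m (by exact_mod_cast hN : (0 : ℤ) < N)
      have := Int.emod_nonneg m (by exact_mod_cast hN.ne' : (N : ℤ) ≠ 0)
      omega
    refine ⟨Sum.inr ⟨⟨_, hq⟩, ⟨(m % N).toNat, hlt⟩⟩, ?_⟩
    refine ((jointOrbit_pow_eq_iff hS N).2 ⟨m / N, γ, hγ, ?_⟩).symm
    have := Int.emod_nonneg m (by exact_mod_cast hN.ne' : (N : ℤ) ≠ 0)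
    have h3 : (N : ℤ) * (m / N) + ((m % N).toNat : ℤ) = m := by
      rw [Int.toNat_of_nonneg this, Int.mul_ediv_add_emod]
    have h4 : ∀ z, (s ^ m) z = (s ^ ((N : ℤ) * (m / N))) ((s ^ ((m % N).toNat : ℤ)) z) :=
      fun z => by rw [← Equiv.Perm.mul_apply, ← zpow_add, h3]
    refine hx.trans ?_
    rw [Equiv.Perm.zpow_apply_comm_of_commute hcomm]
    exact h4 _

/-- A coincidence of orbits yields a power of `s`, with exponent known modulo `N`, that keeps a
representative in its `S`-orbit; off `P` the exponent must vanish. -/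
theorem coverOrbit_injective (hS : ∀ σ ∈ S, Commute σ s) {N : ℕ}
    (rep : JointOrbits s S → D) (hrep : ∀ q, jointOrbit s S (rep q) = q)
    (P : Set (JointOrbits s S))
    (hP : ∀ q ∉ P, ∀ k : ℤ, (s ^ k) (rep q) ∈ MulAction.orbit (Subgroup.closure S) (rep q) →
      k = 0) :
    Function.Injective (coverOrbit N rep P) := by
  have hover : ∀ (k l : ℤ) (q r : JointOrbits s S),
      jointOrbit (s ^ N) S ((s ^ k) (rep q)) = jointOrbit (s ^ N) S ((s ^ l) (rep r)) →
      q = r ∧ (q ∉ P → (N : ℤ) ∣ k - l) := by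
    intro k l q r h
    obtain ⟨m, γ, hγ, h⟩ := (jointOrbit_pow_eq_iff hS N).1 h
    rw [Equiv.Perm.zpow_apply_comm_of_commute (commute_of_mem_closure hS hγ),
      ← Equiv.Perm.mul_apply, ← zpow_add] at h
    have h' : (s ^ (k - (N * m + l))) (rep q) = γ (rep r) := by
      rw [sub_eq_neg_add, zpow_add, Equiv.Perm.mul_apply, h, ← Equiv.Perm.mul_apply, ← zpow_add]
      simp
    have hqr : q = r := by
      rw [← hrep q, ← hrep r]
      refine (jointOrbit_eq_iff hS).2 ⟨-(k - (N * m + l)), γ, hγ, ?_⟩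
      rw [← h', ← Equiv.Perm.mul_apply, ← zpow_add]
      simp
    refine ⟨hqr, fun hq => ⟨m, ?_⟩⟩
    subst hqr
    have := hP q hq _ ⟨⟨γ, hγ⟩, h'.symm⟩
    linarith
  rintro (q | ⟨q, k⟩) (r | ⟨r, l⟩) h
  · exact congrArg Sum.inl (Subtype.ext (hover 0 0 q r (by simpa [coverOrbit] using h)).1)
  · have := (hover 0 l q r (by simpa [coverOrbit] using h)).1
    exact absurd (this ▸ q.2) r.2
  · have := (hover k 0 q r (by simpa [coverOrbit] using h)).1
    exact absurd (this ▸ r.2) q.2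
  · obtain ⟨h1, h2⟩ := hover k l q r h
    have h2 := h2 q.2
    refine congrArg Sum.inr (Prod.ext (Subtype.ext h1) (Fin.ext ?_))
    have hk := k.2
    have hl := l.2
    have h3 : (k : ℤ) - l = 0 := Int.eq_zero_of_abs_lt_dvd h2 (by rw [abs_lt]; omega)
    change (k : ℕ) = l
    omega

theorem finite_jointOrbits_pow (hS : ∀ σ ∈ S, Commute σ s) {N : ℕ} (hN : 0 < N)
    [Finite (JointOrbits s S)] : Finite (JointOrbits (s ^ N) S) :=
  Finite.of_surjective _ (coverOrbit_surjective hS hN Quotient.out (fun q => Quotient.out_eq q) ∅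
    (fun _ h => absurd h (Set.notMem_empty _)))

theorem card_coverOrbit_domain [Finite (JointOrbits s S)] (N : ℕ) (P : Set (JointOrbits s S)) :
    Nat.card (P ⊕ ((Pᶜ : Set (JointOrbits s S)) × Fin N)) =
      P.ncard + Pᶜ.ncard * N := by
  rw [Nat.card_sum, Nat.card_prod, Nat.card_fin]
  rfl

/-- The upper bound needs only that orbits in `P` do not split, the lower bound only that the others
split completely. `euler_cover` needs each cell count from one side only. -/
theorem card_jointOrbits_pow_le [Finite (JointOrbits s S)] (hS : ∀ σ ∈ S, Commute σ s) {N : ℕ}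
    (hN : 0 < N) (rep : JointOrbits s S → D) (hrep : ∀ q, jointOrbit s S (rep q) = q)
    (P : Set (JointOrbits s S))
    (hP : ∀ q ∈ P, s (rep q) ∈ MulAction.orbit (Subgroup.closure S) (rep q)) :
    Nat.card (JointOrbits (s ^ N) S) ≤ P.ncard + Pᶜ.ncard * N := by
  rw [← card_coverOrbit_domain]
  exact Nat.card_le_card_of_surjective _ (coverOrbit_surjective hS hN rep hrep P hP)

theorem le_card_jointOrbits_pow [Finite (JointOrbits s S)] (hS : ∀ σ ∈ S, Commute σ s) {N : ℕ}
    (hN : 0 < N) (rep : JointOrbits s S → D) (hrep : ∀ q, jointOrbit s S (rep q) = q)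
    (P : Set (JointOrbits s S))
    (hP : ∀ q ∉ P, ∀ k : ℤ, (s ^ k) (rep q) ∈ MulAction.orbit (Subgroup.closure S) (rep q) →
      k = 0) :
    P.ncard + Pᶜ.ncard * N ≤ Nat.card (JointOrbits (s ^ N) S) := by
  have := finite_jointOrbits_pow hS hN
  rw [← card_coverOrbit_domain]
  exact Nat.card_le_card_of_injective _ (coverOrbit_injective hS rep hrep P hP)

end OrbitCount

/-! ### Freeness of the translation action on darts. -/

namespace PeriodicGraph

variable {V D : Type*} (G : PeriodicGraph V D)

theorem commute_rev_shiftD : Commute G.rev G.shiftD :=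
  Equiv.ext fun d => G.rev_shift d

theorem tail_zpow (n : ℤ) (d : D) : G.tail ((G.shiftD ^ n) d) = (G.shiftV ^ n) (G.tail d) := by
  have h1 : ∀ d, G.tail (G.shiftD⁻¹ d) = G.shiftV⁻¹ (G.tail d) := fun d => by
    rw [Equiv.Perm.eq_inv_iff_eq, ← G.tail_shift, ← Equiv.Perm.mul_apply, mul_inv_cancel,
      Equiv.Perm.one_apply]
  induction n with
  | zero => simp
  | succ n ih =>
    rw [add_comm, zpow_add, zpow_add, Equiv.Perm.mul_apply, Equiv.Perm.mul_apply, zpow_one,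
      zpow_one, G.tail_shift, ih]
  | pred n ih =>
    rw [sub_eq_neg_add, zpow_add, zpow_add, Equiv.Perm.mul_apply, Equiv.Perm.mul_apply,
      zpow_neg_one, zpow_neg_one, h1, ih]

theorem rev_zpow (n : ℤ) (d : D) : G.rev ((G.shiftD ^ n) d) = (G.shiftD ^ n) (G.rev d) :=
  Equiv.Perm.zpow_apply_comm_of_commute G.commute_rev_shiftD n d

theorem eq_zero_of_tail_zpow_eq {n : ℤ} {d : D} (h : G.tail ((G.shiftD ^ n) d) = G.tail d) :
    n = 0 :=
  G.free n _ (by rw [← tail_zpow, h])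

theorem eq_zero_of_shiftD_zpow_eq {n : ℤ} {d : D} (h : (G.shiftD ^ n) d = d) : n = 0 :=
  G.eq_zero_of_tail_zpow_eq (by rw [h])

/-- This keeps the reversal free of fixed darts in every cyclic cover. -/
theorem shiftD_zpow_ne_rev (n : ℤ) (d : D) : (G.shiftD ^ n) d ≠ G.rev d := by
  intro h
  have h2 : (G.shiftD ^ (n + n)) d = d := by
    rw [zpow_add, Equiv.Perm.mul_apply, h, ← rev_zpow, h, G.rev_rev]
  have := G.eq_zero_of_shiftD_zpow_eq h2
  obtain rfl : n = 0 := by omega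
  exact G.rev_ne d h.symm

theorem finite_jointOrbits (S : Set (Equiv.Perm D)) : Finite (JointOrbits G.shiftD S) := by
  refine Finite.of_surjective (α := G.DartOrbit)
    (Quotient.lift (fun d => jointOrbit G.shiftD S d) ?_) ?_
  · rintro a b ⟨n, rfl⟩
    refine (Quotient.sound ?_ : jointOrbit G.shiftD S a = _)
    refine (MulAction.orbitRel _ _).symm ⟨⟨G.shiftD ^ n, ?_⟩, rfl⟩
    exact Subgroup.zpow_mem _ (Subgroup.subset_closure (Set.mem_insert _ _)) n
  · rintro ⟨d⟩
    exact ⟨Quotient.mk _ d, rfl⟩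

end PeriodicGraph

/-! ### Winding faces and Euler's inequality for the cyclic covers. -/

namespace PlanePeriodicGraph

variable {V D : Type*} (G : PlanePeriodicGraph V D)

theorem commute_rot_shiftD : Commute G.rot G.shiftD :=
  Equiv.ext fun d => G.rot_shift d

theorem rot_zpow (n : ℤ) (d : D) : G.rot ((G.shiftD ^ n) d) = (G.shiftD ^ n) (G.rot d) :=
  Equiv.Perm.zpow_apply_comm_of_commute G.commute_rot_shiftD n d

theorem commute_of_mem_rot : ∀ σ ∈ ({G.rot} : Set (Equiv.Perm D)), Commute σ G.shiftD := by
  rintro _ rfl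
  exact G.commute_rot_shiftD

theorem commute_of_mem_rev : ∀ σ ∈ ({G.rev} : Set (Equiv.Perm D)), Commute σ G.shiftD := by
  rintro _ rfl
  exact G.commute_rev_shiftD

theorem commute_of_mem_face :
    ∀ σ ∈ ({G.rot * G.rev} : Set (Equiv.Perm D)), Commute σ G.shiftD := by
  rintro _ rfl
  exact G.commute_rot_shiftD.mul_left G.commute_rev_shiftD

theorem commute_of_mem_rot_rev :
    ∀ σ ∈ ({G.rot, G.rev} : Set (Equiv.Perm D)), Commute σ G.shiftD := by
  rintro _ (rfl | rfl)
  · exact G.commute_rot_shiftD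
  · exact G.commute_rev_shiftD

theorem mem_orbit_closure_singleton {σ : Equiv.Perm D} {d e : D} :
    e ∈ MulAction.orbit (Subgroup.closure {σ}) d ↔ σ.SameCycle d e := by
  constructor
  · rintro ⟨⟨g, hg⟩, rfl⟩
    obtain ⟨n, rfl⟩ := Subgroup.mem_closure_singleton.1 hg
    exact ⟨n, rfl⟩
  · rintro ⟨n, rfl⟩
    exact ⟨⟨σ ^ n, Subgroup.mem_closure_singleton.2 ⟨n, rfl⟩⟩, rfl⟩

theorem tail_eq_of_mem_closure_rot {γ : Equiv.Perm D} (hγ : γ ∈ Subgroup.closure {G.rot}) (d : D) :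
    G.tail (γ d) = G.tail d :=
  ((G.tail_eq_iff _ _).2 (mem_orbit_closure_singleton.1 ⟨⟨γ, hγ⟩, rfl⟩)).symm

/-- Vertices become orbits of darts, like the other cells; `no_isolated` ensures that none is lost.
-/
theorem card_vertexOrbit_eq :
    Nat.card G.VertexOrbit = Nat.card (JointOrbits G.shiftD {G.rot}) := by
  symm
  refine Nat.card_eq_of_bijective (Quotient.lift (fun d => G.vertexOrbit (G.tail d)) ?_) ⟨?_, ?_⟩
  · intro a b h
    obtain ⟨m, γ, hγ, rfl⟩ := (jointOrbit_eq_iff G.commute_of_mem_rot).1 (Quotient.sound h)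
    refine (Quotient.sound ⟨m, ?_⟩ : G.vertexOrbit _ = _).symm
    rw [G.tail_zpow, G.tail_eq_of_mem_closure_rot hγ]
  · rintro ⟨a⟩ ⟨b⟩ h
    obtain ⟨m, hm⟩ := Quotient.exact h
    refine ((jointOrbit_eq_iff G.commute_of_mem_rot).2 ?_).symm
    have h1 : G.tail ((G.shiftD ^ m) a) = G.tail b := by rw [G.tail_zpow, hm]
    obtain ⟨⟨γ, hγ⟩, h2⟩ := mem_orbit_closure_singleton.2 ((G.tail_eq_iff _ _).1 h1)
    refine ⟨m, γ, hγ, ?_⟩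
    rw [← Equiv.Perm.zpow_apply_comm_of_commute
      (commute_of_mem_closure G.commute_of_mem_rot hγ)]
    exact h2.symm
  · rintro ⟨v⟩
    obtain ⟨d, rfl⟩ := G.no_isolated v
    exact ⟨jointOrbit _ _ d, rfl⟩

/-- The faces of the quotient graph whose boundary winds around the annulus. -/
def windingFaces : Set (JointOrbits G.shiftD {G.rot * G.rev}) :=
  {q | (G.rot * G.rev).SameCycle q.out (G.shiftD q.out)}

/-- The component of the quotient graph to which a face belongs. -/
noncomputable def faceComponent :
    JointOrbits G.shiftD {G.rot * G.rev} → JointOrbits G.shiftD {G.rot, G.rev} :=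
  fun q => jointOrbit _ _ q.out

theorem zpow_mem_closure_rot_rev (n : ℤ) :
    (G.rot * G.rev) ^ n ∈ Subgroup.closure {G.rot, G.rev} :=
  Subgroup.zpow_mem _ (Subgroup.mul_mem _ (Subgroup.subset_closure (by simp))
    (Subgroup.subset_closure (by simp))) n

/-- A boundary walk of `d` that closes up in the cover does not wind. -/
theorem eq_zero_of_closed_face {d : D} {k : ℕ} (hk : 0 < k) (h : ((G.rot * G.rev) ^ k) d = d)
    {n : ℤ} (hn : (G.rot * G.rev).SameCycle d ((G.shiftD ^ n) d)) : n = 0 := by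
  obtain ⟨j, hj⟩ := hn
  have hc : Commute (G.rot * G.rev) G.shiftD := G.commute_of_mem_face _ rfl
  have h1 : (((G.rot * G.rev) ^ j)⁻¹ * G.shiftD ^ n) d = d := by
    rw [Equiv.Perm.mul_apply, ← hj, ← Equiv.Perm.mul_apply, inv_mul_cancel, Equiv.Perm.one_apply]
  -- In the `k`-th power the face walk contributes nothing, so `shiftD ^ (n * k)` fixes `d`.
  have h2 : ((((G.rot * G.rev) ^ j)⁻¹ * G.shiftD ^ n) ^ k) d = d := Function.IsFixedPt.perm_pow h1 k
  have h3 : (((G.rot * G.rev) ^ k) ^ j) d = d := Function.IsFixedPt.perm_zpow h j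
  rw [((hc.zpow_zpow j n).inv_left).mul_pow, Equiv.Perm.mul_apply, inv_pow,
    Equiv.Perm.inv_eq_iff_eq, ← zpow_natCast, ← zpow_mul, ← zpow_natCast, ← zpow_mul, mul_comm j,
    zpow_mul _ _ j, zpow_natCast, h3] at h2
  have := G.eq_zero_of_shiftD_zpow_eq h2
  rcases Int.mul_eq_zero.1 this with h | h
  · exact h
  · omega

/-- The boundary walk through `d` climbs by one period. -/
def IsUpward (d : D) : Prop := ∃ k : ℕ, 0 < k ∧ ((G.rot * G.rev) ^ k) d = G.shiftD d

/-- The boundary walk through `d` descends by one period. -/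
def IsDownward (d : D) : Prop := ∃ k : ℕ, 0 < k ∧ ((G.rot * G.rev) ^ k) d = G.shiftD.symm d

theorem pow_face_zpow (k : ℕ) (n : ℤ) (d : D) :
    ((G.rot * G.rev) ^ k) ((G.shiftD ^ n) d) = (G.shiftD ^ n) (((G.rot * G.rev) ^ k) d) :=
  Equiv.Perm.zpow_apply_comm_of_commute ((G.commute_of_mem_face _ rfl).pow_left k) n d

theorem IsUpward.zpow {G : PlanePeriodicGraph V D} {d : D} (h : G.IsUpward d) (n : ℤ) :
    G.IsUpward ((G.shiftD ^ n) d) := by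
  obtain ⟨k, hk, h⟩ := h
  refine ⟨k, hk, ?_⟩
  rw [pow_face_zpow, h]
  exact Equiv.Perm.congr_fun ((Commute.refl G.shiftD).zpow_left n).eq d

theorem IsDownward.zpow {G : PlanePeriodicGraph V D} {d : D} (h : G.IsDownward d) (n : ℤ) :
    G.IsDownward ((G.shiftD ^ n) d) := by
  obtain ⟨k, hk, h⟩ := h
  refine ⟨k, hk, ?_⟩
  rw [pow_face_zpow, h]
  exact Equiv.Perm.congr_fun ((Commute.refl G.shiftD).inv_right.zpow_left n).eq d

theorem upward_or_downward {d : D} (h : (G.rot * G.rev).SameCycle d (G.shiftD d)) :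
    G.IsUpward d ∨ G.IsDownward d := by
  obtain ⟨k, hk, h1 | h1 | h1⟩ := G.winding d
  · have := G.eq_zero_of_closed_face hk h1 (n := 1) (by simpa using h)
    omega
  · exact Or.inl ⟨k, hk, h1⟩
  · exact Or.inr ⟨k, hk, h1⟩

theorem jointOrbit_out (s : Equiv.Perm D) (S : Set (Equiv.Perm D)) (q : JointOrbits s S) :
    jointOrbit s S q.out = q := Quotient.out_eq q

/-- Two faces in one component of the quotient need not lie in one component of the strip; a
translate of the second does, and `p` survives translation. -/
theorem face_eq_of_faceComponent_eq {p : D → Prop} (hp : ∀ d (n : ℤ), p d → p ((G.shiftD ^ n) d))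
    (huniq : ∀ d e, d ∈ MulAction.orbit (Subgroup.closure {G.rot, G.rev}) e → p d → p e →
      (G.rot * G.rev).SameCycle d e)
    {q r : JointOrbits G.shiftD {G.rot * G.rev}} (hqr : G.faceComponent q = G.faceComponent r)
    (hq : p q.out) (hr : p r.out) : q = r := by
  obtain ⟨m, γ, hγ, h⟩ := (jointOrbit_eq_iff G.commute_of_mem_rot_rev).1 hqr
  rw [← Equiv.Perm.zpow_apply_comm_of_commute
    (commute_of_mem_closure G.commute_of_mem_rot_rev hγ)] at h
  obtain ⟨j, hj⟩ := huniq q.out ((G.shiftD ^ m) r.out) ⟨⟨γ, hγ⟩, h.symm⟩ hq (hp _ m hr)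
  rw [← jointOrbit_out _ _ q, ← jointOrbit_out _ _ r]
  refine ((jointOrbit_eq_iff G.commute_of_mem_face).2
    ⟨-m, (G.rot * G.rev) ^ j, Subgroup.mem_closure_singleton.2 ⟨j, rfl⟩, ?_⟩).symm
  rw [hj, ← Equiv.Perm.mul_apply, ← zpow_add]
  simp

/-- A component has at most one climbing and one descending face, so component and direction
determine a winding face. -/
theorem ncard_windingFaces_le :
    G.windingFaces.ncard ≤ 2 * (G.faceComponent '' G.windingFaces).ncard := by
  classical
  have := G.finite_jointOrbits {G.rot * G.rev}
  have := G.finite_jointOrbits {G.rot, G.rev}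
  let f : G.windingFaces → (G.faceComponent '' G.windingFaces) × Bool :=
    fun q => (⟨G.faceComponent q, Set.mem_image_of_mem _ q.2⟩, decide (G.IsUpward q.1.out))
  have hf : Function.Injective f := by
    rintro ⟨q, hq⟩ ⟨r, hr⟩ h
    have h1 : G.faceComponent q = G.faceComponent r := congrArg (fun z => z.1.1) h
    have h2 : (G.IsUpward q.out ↔ G.IsUpward r.out) :=
      decide_eq_decide.1 (congrArg Prod.snd h)
    refine Subtype.ext ?_
    by_cases hu : G.IsUpward q.out
    · exact G.face_eq_of_faceComponent_eq (p := G.IsUpward) (fun d n h => h.zpow n)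
        G.upward_unique h1 hu (h2.1 hu)
    · exact G.face_eq_of_faceComponent_eq (p := G.IsDownward) (fun d n h => h.zpow n)
        G.downward_unique h1 ((G.upward_or_downward hq).resolve_left hu)
        ((G.upward_or_downward hr).resolve_left fun h => hu (h2.2 h))
  have := Nat.card_le_card_of_injective f hf
  rw [Nat.card_prod, Nat.card_eq_fintype_card (α := Bool), Fintype.card_bool, mul_comm] at this
  exact this

/-- Representatives of the components, on a winding face if there is one. -/
theorem exists_component_rep (c : JointOrbits G.shiftD {G.rot, G.rev}) :
    ∃ d, jointOrbit _ _ d = c ∧ (c ∈ G.faceComponent '' G.windingFaces →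
      G.shiftD d ∈ MulAction.orbit (Subgroup.closure {G.rot, G.rev}) d) := by
  by_cases hc : c ∈ G.faceComponent '' G.windingFaces
  · obtain ⟨q, ⟨j, hj⟩, rfl⟩ := hc
    exact ⟨q.out, rfl, fun _ => ⟨⟨_, G.zpow_mem_closure_rot_rev j⟩, hj⟩⟩
  · exact ⟨c.out, jointOrbit_out _ _ c, fun h => absurd h hc⟩

/-- Euler's inequality for the `N`-fold cyclic covers of the quotient graph. -/
theorem euler_cover {N : ℕ} (hN : 0 < N) :
    Nat.card (JointOrbits (G.shiftD ^ N) {G.rev}) +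
      2 * Nat.card (JointOrbits (G.shiftD ^ N) {G.rot, G.rev}) ≤
    Nat.card (JointOrbits (G.shiftD ^ N) {G.rot}) +
      Nat.card (JointOrbits (G.shiftD ^ N) {G.rot * G.rev}) := by
  have := G.finite_jointOrbits {G.rot * G.rev}
  have := G.finite_jointOrbits {G.rot, G.rev}
  have := G.finite_jointOrbits {G.rot}
  have := G.finite_jointOrbits {G.rev}
  choose rep hrep hrep' using G.exists_component_rep
  have hv := le_card_jointOrbits_pow G.commute_of_mem_rot hN Quotient.out
    (fun q => Quotient.out_eq q) ∅ (fun q _ k ⟨⟨γ, hγ⟩, h⟩ => by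
      refine G.eq_zero_of_tail_zpow_eq (d := q.out) ?_
      rw [← h]
      exact G.tail_eq_of_mem_closure_rot hγ _)
  have he := card_jointOrbits_pow_le G.commute_of_mem_rev hN Quotient.out
    (fun q => Quotient.out_eq q) ∅ (fun q h => absurd h (Set.notMem_empty _))
  have hc := card_jointOrbits_pow_le G.commute_of_mem_rot_rev hN rep hrep
    (G.faceComponent '' G.windingFaces) hrep'
  have hf := le_card_jointOrbits_pow G.commute_of_mem_face hN Quotient.out
    (fun q => Quotient.out_eq q) G.windingFaces (fun q hq k hk => by
      have hq : ¬ (G.rot * G.rev).SameCycle q.out (G.shiftD q.out) := hq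
      rw [mem_orbit_closure_singleton] at hk
      obtain ⟨j, hj, h1 | h1 | h1⟩ := G.winding q.out
      · exact G.eq_zero_of_closed_face hj h1 hk
      · exact absurd ⟨j, by simpa using h1⟩ hq
      · refine absurd (Equiv.Perm.SameCycle.symm ⟨j, ?_⟩) hq
        -- Translated by one period, a descending walk leads from `shiftD d` back to `d`.
        have := G.pow_face_zpow j 1 q.out
        rw [h1, zpow_one, Equiv.apply_symm_apply] at this
        simpa using this)
  have hw := G.ncard_windingFaces_le
  have heul := G.euler
  have hv1 := G.card_vertexOrbit_eq
  have hf1 := Set.ncard_add_ncard_compl G.windingFaces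
  have hc1 := Set.ncard_add_ncard_compl (G.faceComponent '' G.windingFaces)
  simp only [Set.ncard_empty, Set.compl_empty, Set.ncard_univ, zero_add] at hv he
  change Nat.card G.VertexOrbit + Nat.card (JointOrbits G.shiftD {G.rot * G.rev}) =
    Nat.card (JointOrbits G.shiftD {G.rev}) +
      2 * Nat.card (JointOrbits G.shiftD {G.rot, G.rev}) at heul
  rw [hv1] at heul
  -- With `w` winding faces in `c` components, `N` times Euler's formula reduces the claim to `(N -
  -- 1) * w ≤ 2 * (N - 1) * c`.
  nlinarith

end PlanePeriodicGraph

/-! ### The `N`-fold cyclic cover as a finite set of darts. -/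

namespace PeriodicGraph

variable {V D : Type*} (G : PeriodicGraph V D)

theorem zpow_level (v : V) : (G.shiftV ^ G.level v) (Quotient.out (G.vertexOrbit v)) = v :=
  (G.exists_level v).choose_spec

theorem vertexOrbit_zpow (n : ℤ) (v : V) : G.vertexOrbit ((G.shiftV ^ n) v) = G.vertexOrbit v :=
  (Quotient.sound ⟨n, rfl⟩ : G.vertexOrbit v = _).symm

theorem level_zpow (n : ℤ) (v : V) : G.level ((G.shiftV ^ n) v) = n + G.level v := by
  have h := G.zpow_level ((G.shiftV ^ n) v)
  rw [vertexOrbit_zpow] at h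
  have h2 : (G.shiftV ^ (-(n + G.level v) + G.level ((G.shiftV ^ n) v)))
      (Quotient.out (G.vertexOrbit v)) = Quotient.out (G.vertexOrbit v) := by
    rw [zpow_add, Equiv.Perm.mul_apply, h, zpow_neg, Equiv.Perm.inv_eq_iff_eq, zpow_add,
      Equiv.Perm.mul_apply, zpow_level]
  have := G.free _ _ h2
  omega

theorem voltage_zpow (n : ℤ) (d : D) : G.voltage ((G.shiftD ^ n) d) = G.voltage d := by
  rw [voltage, voltage, rev_zpow, tail_zpow, tail_zpow, level_zpow, level_zpow]
  ring

/-- The orbit of a dart. -/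
def dartOrbit (d : D) : G.DartOrbit := Quotient.mk _ d

theorem exists_zpow_out (d : D) : ∃ n : ℤ, (G.shiftD ^ n) (G.dartOrbit d).out = d :=
  Quotient.mk_out (s := Equiv.Perm.SameCycle.setoid G.shiftD) d

theorem dartOrbit_zpow (n : ℤ) (d : D) : G.dartOrbit ((G.shiftD ^ n) d) = G.dartOrbit d :=
  (Quotient.sound ⟨n, rfl⟩ : G.dartOrbit d = _).symm

theorem voltage_out (d : D) : G.voltage (G.dartOrbit d).out = G.voltage d := by
  obtain ⟨n, hn⟩ := G.exists_zpow_out d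
  conv_rhs => rw [← hn, voltage_zpow]

/-- The projection of the darts to those of the `N`-fold cyclic cover of the quotient graph. -/
noncomputable def coverProj (N : ℕ) (d : D) : G.DartOrbit × ZMod N :=
  (G.dartOrbit d, (G.level (G.tail d) : ZMod N))

theorem coverProj_zpow_sub (N : ℕ) (q : G.DartOrbit) (n : ℤ) :
    G.coverProj N ((G.shiftD ^ (n - G.level (G.tail q.out))) q.out) = (q, (n : ZMod N)) := by
  refine Prod.ext ?_ ?_
  · change G.dartOrbit _ = q
    rw [dartOrbit_zpow]
    exact Quotient.out_eq q
  · change ((G.level _ : ℤ) : ZMod N) = n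
    rw [tail_zpow, level_zpow, sub_add_cancel]

theorem coverProj_surjective (N : ℕ) : Function.Surjective (G.coverProj N) := by
  rintro ⟨q, k⟩
  obtain ⟨n, rfl⟩ := ZMod.intCast_surjective k
  exact ⟨_, G.coverProj_zpow_sub N q n⟩

theorem coverProj_eq_iff (N : ℕ) {d e : D} :
    G.coverProj N e = G.coverProj N d ↔ ∃ m : ℤ, e = (G.shiftD ^ (N * m)) d := by
  constructor
  · intro h
    obtain ⟨m, rfl⟩ := Quotient.exact (congrArg Prod.fst h).symm
    have h2 := congrArg Prod.snd h
    change ((G.level _ : ℤ) : ZMod N) = _ at h2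
    rw [tail_zpow, level_zpow] at h2
    have h3 : ((m : ℤ) : ZMod N) = 0 := by simpa [coverProj] using h2
    obtain ⟨k, rfl⟩ := (ZMod.intCast_zmod_eq_zero_iff_dvd m N).1 h3
    exact ⟨k, rfl⟩
  · rintro ⟨m, rfl⟩
    refine Prod.ext (G.dartOrbit_zpow _ d) ?_
    change ((G.level _ : ℤ) : ZMod N) = _
    rw [tail_zpow, level_zpow]
    simp [coverProj]

/-- A permutation of the darts that commutes with the shift acts on the `N`-fold cyclic cover. -/
noncomputable def coverPerm (N : ℕ) (σ : Equiv.Perm D) (hσ : Commute σ G.shiftD) :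
    Equiv.Perm (G.DartOrbit × ZMod N) :=
  -- The result does not depend on the lift, since lifts differ by a translation and `τ` commutes
  -- with it.
  have key : ∀ τ : Equiv.Perm D, Commute τ G.shiftD → ∀ d,
      G.coverProj N (τ (Function.surjInv (G.coverProj_surjective N) (G.coverProj N d))) =
        G.coverProj N (τ d) := by
    intro τ hτ d
    obtain ⟨m, hm⟩ := (G.coverProj_eq_iff N).1
      (Function.surjInv_eq (G.coverProj_surjective N) (G.coverProj N d))
    refine (G.coverProj_eq_iff N).2 ⟨m, ?_⟩
    rw [← Equiv.Perm.zpow_apply_comm_of_commute hτ, ← hm]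
  { toFun := fun x => G.coverProj N (σ (Function.surjInv (G.coverProj_surjective N) x))
    invFun := fun x => G.coverProj N (σ⁻¹ (Function.surjInv (G.coverProj_surjective N) x))
    left_inv := by
      intro x
      obtain ⟨d, rfl⟩ := G.coverProj_surjective N x
      dsimp only
      rw [key σ hσ, key σ⁻¹ hσ.inv_left, ← Equiv.Perm.mul_apply, inv_mul_cancel,
        Equiv.Perm.one_apply]
    right_inv := by
      intro x
      obtain ⟨d, rfl⟩ := G.coverProj_surjective N x
      dsimp only
      rw [key σ⁻¹ hσ.inv_left, key σ hσ, ← Equiv.Perm.mul_apply, mul_inv_cancel,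
        Equiv.Perm.one_apply] }

@[simp] theorem coverPerm_coverProj (N : ℕ) (σ : Equiv.Perm D) (hσ : Commute σ G.shiftD) (d : D) :
    G.coverPerm N σ hσ (G.coverProj N d) = G.coverProj N (σ d) := by
  obtain ⟨m, hm⟩ := (G.coverProj_eq_iff N).1
    (Function.surjInv_eq (G.coverProj_surjective N) (G.coverProj N d))
  refine (G.coverProj_eq_iff N).2 ⟨m, ?_⟩
  rw [← Equiv.Perm.zpow_apply_comm_of_commute hσ, ← hm]

theorem coverPerm_symm_coverProj (N : ℕ) (σ : Equiv.Perm D) (hσ : Commute σ G.shiftD) (d : D) :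
    (G.coverPerm N σ hσ).symm (G.coverProj N d) = G.coverProj N (σ.symm d) := by
  rw [Equiv.symm_apply_eq, coverPerm_coverProj, Equiv.apply_symm_apply]

/-- Invariant functions are functions on orbits. Stating the invariance through `hT` lets one lemma
count vertices, edges, faces and components. -/
theorem finrank_invariantFunctions_cover {N : ℕ} [NeZero N] {S : Set (Equiv.Perm D)}
    (hS : ∀ σ ∈ S, Commute σ G.shiftD) (T : Set (Equiv.Perm (G.DartOrbit × ZMod N)))
    (hT : ∀ f, f ∈ invariantFunctions T ↔
      ∀ σ ∈ S, ∀ d, f (G.coverProj N (σ d)) = f (G.coverProj N d)) :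
    Module.finrank (ZMod 2) (invariantFunctions T) =
      Nat.card (JointOrbits (G.shiftD ^ N) S) := by
  have := G.finite_jointOrbits S
  have := finite_jointOrbits_pow hS (NeZero.pos N)
  have := Fintype.ofFinite (JointOrbits (G.shiftD ^ N) S)
  let m : G.DartOrbit × ZMod N → JointOrbits (G.shiftD ^ N) S :=
    fun x => jointOrbit _ S (Function.surjInv (G.coverProj_surjective N) x)
  have hm : ∀ d, m (G.coverProj N d) = jointOrbit _ S d := by
    intro d
    obtain ⟨k, hk⟩ := (G.coverProj_eq_iff N).1
      (Function.surjInv_eq (G.coverProj_surjective N) (G.coverProj N d))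
    exact (jointOrbit_pow_eq_iff hS N).2 ⟨k, 1, Subgroup.one_mem _, hk⟩
  have hsurj : Function.Surjective m := by
    rintro ⟨d⟩
    exact ⟨_, hm d⟩
  have hrange : LinearMap.range (LinearMap.funLeft (ZMod 2) (ZMod 2) m) =
      invariantFunctions T := by
    ext f
    rw [hT]
    constructor
    · rintro ⟨g, rfl⟩ σ hσ d
      rw [LinearMap.funLeft_apply, LinearMap.funLeft_apply, hm, hm]
      exact congrArg g ((jointOrbit_pow_eq_iff hS N).2
        ⟨0, σ, Subgroup.subset_closure hσ, by simp⟩)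
    · intro h
      have hγ : ∀ γ ∈ Subgroup.closure S, ∀ d,
          f (G.coverProj N (γ d)) = f (G.coverProj N d) := by
        intro γ hγ
        induction hγ using Subgroup.closure_induction with
        | mem x hx => exact h x hx
        | one => exact fun _ => rfl
        | mul x y _ _ hx hy => exact fun d => (hx (y d)).trans (hy d)
        | inv x _ hx =>
          intro d
          rw [← hx, ← Equiv.Perm.mul_apply, mul_inv_cancel, Equiv.Perm.one_apply]
      refine ⟨Quotient.lift (fun d => f (G.coverProj N d)) ?_, ?_⟩
      · intro a b hab
        obtain ⟨k, γ, hγ', rfl⟩ := (jointOrbit_pow_eq_iff hS N).1 (Quotient.sound hab)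
        exact (congrArg f ((G.coverProj_eq_iff N).2 ⟨k, rfl⟩)).trans (hγ γ hγ' b)
      · ext x
        obtain ⟨d, rfl⟩ := G.coverProj_surjective N x
        rw [LinearMap.funLeft_apply, hm]
        rfl
  rw [← hrange, LinearMap.finrank_range_of_inj
    (LinearMap.funLeft_injective_of_surjective _ _ _ hsurj), Module.finrank_fintype_fun_eq_card,
    Nat.card_eq_fintype_card]

end PeriodicGraph

/-! ### The rotation system of the cover. -/

namespace PlanePeriodicGraph

variable {V D : Type*} (G : PlanePeriodicGraph V D)

/-- The rotation of the `N`-fold cyclic cover of the quotient graph. -/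
noncomputable def coverRot (N : ℕ) : Equiv.Perm (G.DartOrbit × ZMod N) :=
  G.coverPerm N G.rot G.commute_rot_shiftD

/-- The reversal of darts in the `N`-fold cyclic cover of the quotient graph. -/
noncomputable def coverRev (N : ℕ) : Equiv.Perm (G.DartOrbit × ZMod N) :=
  G.coverPerm N G.rev G.commute_rev_shiftD

@[simp] theorem coverRot_coverProj (N : ℕ) (d : D) :
    G.coverRot N (G.coverProj N d) = G.coverProj N (G.rot d) :=
  G.coverPerm_coverProj N _ _ d

@[simp] theorem coverRev_coverProj (N : ℕ) (d : D) :
    G.coverRev N (G.coverProj N d) = G.coverProj N (G.rev d) :=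
  G.coverPerm_coverProj N _ _ d

@[simp] theorem coverRot_symm_coverProj (N : ℕ) (d : D) :
    (G.coverRot N).symm (G.coverProj N d) = G.coverProj N (G.rot.symm d) :=
  G.coverPerm_symm_coverProj N _ _ d

theorem coverRev_coverRev (N : ℕ) (x : G.DartOrbit × ZMod N) :
    G.coverRev N (G.coverRev N x) = x := by
  obtain ⟨d, rfl⟩ := G.coverProj_surjective N x
  rw [coverRev_coverProj, coverRev_coverProj, G.rev_rev]

theorem coverRev_ne (N : ℕ) (x : G.DartOrbit × ZMod N) : G.coverRev N x ≠ x := by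
  obtain ⟨d, rfl⟩ := G.coverProj_surjective N x
  rw [coverRev_coverProj]
  intro h
  obtain ⟨m, hm⟩ := (G.coverProj_eq_iff N).1 h
  exact G.shiftD_zpow_ne_rev _ _ hm.symm

theorem card_medialColorings_eq (N : ℕ) [NeZero N] :
    Nat.card (medialColorings (G.coverRot N) (G.coverRev N)) =
      Nat.card (harmonicFunctions (G.coverRot N) (G.coverRev N)) := by
  rw [Module.natCard_eq_pow_finrank (K := ZMod 2),
    Module.natCard_eq_pow_finrank (K := ZMod 2) (V := harmonicFunctions _ _),
    finrank_medialColorings_eq _ _ (G.coverRev_coverRev N) (G.coverRev_ne N)]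
  have hsurj := fun p : G.DartOrbit × ZMod N → Prop => (G.coverProj_surjective N).forall (p := p)
  rw [G.finrank_invariantFunctions_cover G.commute_of_mem_rev {G.coverRev N},
    G.finrank_invariantFunctions_cover G.commute_of_mem_rot {G.coverRot N},
    G.finrank_invariantFunctions_cover G.commute_of_mem_face {G.coverRot N * G.coverRev N},
    G.finrank_invariantFunctions_cover G.commute_of_mem_rot_rev {G.coverRot N, G.coverRev N}]
  · exact G.euler_cover (NeZero.pos N)
  all_goals
    intro f
    simp only [mem_invariantFunctions_singleton, mem_invariantFunctions_pair, hsurj]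
    simp

end PlanePeriodicGraph

/-! ### Laurent polynomials acting as linear recurrences. -/

section Translation

open LaurentPolynomial

/-- The action of `ℤ` by translations on the functions on a ring. -/
def translationHom (A : Type*) [CommRing A] :
    Multiplicative ℤ →* Module.End (ZMod 2) (A → ZMod 2) where
  toFun n := LinearMap.funLeft (ZMod 2) (ZMod 2) fun k => k + ((Multiplicative.toAdd n : ℤ) : A)
  map_one' := by
    ext a k
    simp [LinearMap.funLeft_apply]
  map_mul' m n := by
    refine LinearMap.ext fun a => funext fun k => ?_
    simp only [LinearMap.funLeft_apply, Module.End.mul_apply, toAdd_mul, Int.cast_add, add_assoc]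

/-- The action of Laurent polynomials by translations on the functions on a ring. -/
noncomputable def translationAction (A : Type*) [CommRing A] :
    (ZMod 2)[T;T⁻¹] →ₐ[ZMod 2] Module.End (ZMod 2) (A → ZMod 2) :=
  AddMonoidAlgebra.lift (ZMod 2) _ ℤ (translationHom A)

theorem translationAction_apply {A : Type*} [CommRing A] (p : (ZMod 2)[T;T⁻¹]) (a : A → ZMod 2)
    (k : A) : translationAction A p a k = ∑ n ∈ p.coeff.support, p.coeff n * a (k + (n : A)) := by
  rw [translationAction, AddMonoidAlgebra.lift_apply, Finsupp.sum, LinearMap.sum_apply,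
    Finset.sum_apply]
  rfl

theorem translationAction_T {A : Type*} [CommRing A] (n : ℤ) (a : A → ZMod 2) (k : A) :
    translationAction A (T n) a k = a (k + (n : A)) := by
  rw [translationAction, T, AddMonoidAlgebra.lift_single, one_smul]
  rfl

/-- The extreme coefficients are nonzero, so the recurrence can be solved in both directions and a
window of zeros spreads. The window has `hi - lo + 1` entries, one more than necessary, so that it
is nonempty for a monomial too. -/
theorem eq_zero_of_translationAction_eq_zero {p : (ZMod 2)[T;T⁻¹]} {lo hi : ℤ}
    (hlo : p.coeff lo ≠ 0) (hhi : p.coeff hi ≠ 0) (hp : ∀ n ∈ p.coeff.support, lo ≤ n ∧ n ≤ hi) {a : ℤ → ZMod 2}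
    (ha : translationAction ℤ p a = 0) (h0 : ∀ t, 0 ≤ t → t ≤ hi - lo → a t = 0) : a = 0 := by
  have hle : lo ≤ hi := (hp lo (Finsupp.mem_support_iff.2 hlo)).2
  have hsum : ∀ k, ∑ n ∈ p.coeff.support, p.coeff n * a (k + n) = 0 := fun k => by
    have := congrFun ha k
    rw [translationAction_apply] at this
    simpa using this
  have hall : ∀ m t : ℤ, 0 ≤ t → t ≤ hi - lo → a (m + t) = 0 := by
    intro m
    induction m with
    | zero => simpa using h0
    | succ m ih =>
      intro t ht ht'
      rcases ht'.lt_or_eq with h | rfl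
      · have := ih (t + 1) (by omega) (by omega)
        rwa [show (m : ℤ) + 1 + t = m + (t + 1) by ring]
      · have h1 := hsum (m + 1 - lo)
        rw [Finset.sum_eq_single hi] at h1
        · rw [show (m : ℤ) + 1 + (hi - lo) = m + 1 - lo + hi by ring]
          exact (mul_eq_zero.1 h1).resolve_left hhi
        · intro n hn hne
          have := hp n hn
          have h2 := ih (1 + n - lo) (by omega) (by omega)
          rw [show (m : ℤ) + 1 - lo + n = m + (1 + n - lo) by ring, h2, mul_zero]
        · intro h
          exact absurd (Finsupp.mem_support_iff.2 hhi) h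
    | pred m ih =>
      intro t ht ht'
      rcases ht.lt_or_eq with h | rfl
      · have := ih (t - 1) (by omega) (by omega)
        rwa [show -(m : ℤ) - 1 + t = -m + (t - 1) by ring]
      · have h1 := hsum (-m - 1 - lo)
        rw [Finset.sum_eq_single lo] at h1
        · rw [show -(m : ℤ) - 1 + 0 = -m - 1 - lo + lo by ring]
          exact (mul_eq_zero.1 h1).resolve_left hlo
        · intro n hn hne
          have := hp n hn
          have h2 := ih (n - lo - 1) (by omega) (by omega)
          rw [show -(m : ℤ) - 1 - lo + n = -m + (n - lo - 1) by ring, h2, mul_zero]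
        · intro h
          exact absurd (Finsupp.mem_support_iff.2 hlo) h
  ext m
  simpa using hall m 0 le_rfl (by omega)

/-- Only finitely many functions on `ℤ` satisfy a given nontrivial linear recurrence. -/
theorem finite_translationAction_eq_zero {p : (ZMod 2)[T;T⁻¹]} (hp : p ≠ 0) :
    {a : ℤ → ZMod 2 | translationAction ℤ p a = 0}.Finite := by
  have hne : p.coeff.support.Nonempty := Finsupp.support_nonempty_iff.2 (AddMonoidAlgebra.coeff_eq_zero.not.2 hp)
  set lo := p.coeff.support.min' hne
  set hi := p.coeff.support.max' hne
  let f : {a : ℤ → ZMod 2 | translationAction ℤ p a = 0} → (Finset.Icc 0 (hi - lo) → ZMod 2) :=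
    fun a t => a.1 t
  have hf : Function.Injective f := by
    rintro ⟨a, ha⟩ ⟨b, hb⟩ hab
    refine Subtype.ext (sub_eq_zero.1 ?_)
    refine eq_zero_of_translationAction_eq_zero (p := p) (lo := lo) (hi := hi)
      (Finsupp.mem_support_iff.1 (Finset.min'_mem _ hne))
      (Finsupp.mem_support_iff.1 (Finset.max'_mem _ hne))
      (fun n hn => ⟨Finset.min'_le _ _ hn, Finset.le_max' _ _ hn⟩) ?_ fun t ht ht' => ?_
    · rw [map_sub, show translationAction ℤ p a = 0 from ha,
        show translationAction ℤ p b = 0 from hb, sub_zero]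
    · exact sub_eq_zero.2 (congrFun hab ⟨t, Finset.mem_Icc.2 ⟨ht, ht'⟩⟩)
  exact Finite.of_injective f hf

open Classical in
/-- A nonzero Laurent polynomial acts nontrivially on cyclic groups of large order. -/
theorem eventually_translationAction_single_ne_zero {p : (ZMod 2)[T;T⁻¹]} (hp : p ≠ 0) :
    ∀ᶠ N : ℕ in Filter.atTop,
      translationAction (ZMod N) p (Pi.single (0 : ZMod N) (1 : ZMod 2)) ≠ 0 := by
  obtain ⟨n₀, hn₀⟩ := Finsupp.support_nonempty_iff.2 (AddMonoidAlgebra.coeff_eq_zero.not.2 hp)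
  have : ∀ᶠ N : ℕ in Filter.atTop, ∀ n ∈ p.coeff.support, |n - n₀| < N := by
    rw [Filter.eventually_all_finset]
    intro n _
    filter_upwards [Filter.eventually_gt_atTop (n - n₀).natAbs] with N hN
    rw [Int.abs_eq_natAbs]
    exact_mod_cast hN
  filter_upwards [this] with N hN h
  -- At `-n₀` only the exponent `n₀` reaches the point mass, because the others are not congruent to
  -- it modulo `N`.
  have h1 := congrFun h (-(n₀ : ZMod N))
  rw [translationAction_apply, Finset.sum_eq_single n₀] at h1
  · rw [neg_add_cancel, Pi.single_eq_same, mul_one] at h1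
    exact Finsupp.mem_support_iff.1 hn₀ h1
  · intro n hn hne
    rw [Pi.single_eq_of_ne, mul_zero]
    intro h2
    have h3 : ((n - n₀ : ℤ) : ZMod N) = 0 := by
      rw [← h2]
      push_cast
      ring
    have := Int.eq_zero_of_abs_lt_dvd ((ZMod.intCast_zmod_eq_zero_iff_dvd _ _).1 h3) (hN n hn)
    omega
  · exact fun h => absurd hn₀ h

end Translation

/-! ### The mod 2 Laplacian and the size of its kernel. -/

namespace PeriodicGraph

open LaurentPolynomial

variable {V D : Type*} (G : PeriodicGraph V D)

/-- The vertex at which a dart of the quotient graph starts. -/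
noncomputable def tailOrbit (q : G.DartOrbit) : G.VertexOrbit := G.vertexOrbit (G.tail q.out)

/-- The vertex at which a dart of the quotient graph ends. -/
noncomputable def headOrbit (q : G.DartOrbit) : G.VertexOrbit :=
  G.vertexOrbit (G.tail (G.rev q.out))

open Classical in
/-- The mod 2 Laplacian on functions on `VertexOrbit × A`. -/
noncomputable def laplaceOperator {A : Type*} [CommRing A] (b : G.VertexOrbit → A → ZMod 2)
    (i : G.VertexOrbit) (k : A) : ZMod 2 :=
  ∑ q : G.DartOrbit, if G.tailOrbit q = i then
    b (G.tailOrbit q) k + b (G.headOrbit q) (k + (G.voltage q.out : A)) else 0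

/-- The kernel of the mod 2 Laplacian on functions on `VertexOrbit × A`. -/
def laplaceKernel (A : Type*) [CommRing A] : Set (G.VertexOrbit → A → ZMod 2) :=
  {b | ∀ i k, G.laplaceOperator b i k = 0}

/-- The Laplacian matrix modulo 2. -/
noncomputable def laplacianModTwo : Matrix G.VertexOrbit G.VertexOrbit (ZMod 2)[T;T⁻¹] :=
  G.laplacian.map (AddMonoidAlgebra.mapRingHom ℤ (Int.castRingHom (ZMod 2)))

open Classical in
theorem det_laplacianModTwo : G.laplacianModTwo.det =
    AddMonoidAlgebra.mapRingHom ℤ (Int.castRingHom (ZMod 2)) G.laplacianPolynomial :=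
  (RingHom.map_det _ _).symm

theorem intCast_units_zmod_two (u : ℤˣ) : (((u : ℤˣ) : ℤ) : ZMod 2) = 1 := by
  rcases Int.units_eq_one_or u with rfl | rfl <;> decide

-- Signs disappear modulo 2, and degree and adjacency merge into one sum over darts, the form of
-- `laplaceOperator`.
open Classical in
theorem laplacianModTwo_apply (i j : G.VertexOrbit) : G.laplacianModTwo i j =
    ∑ q : G.DartOrbit, if G.tailOrbit q = i then
      (if G.tailOrbit q = j then 1 else 0) +
        (if G.headOrbit q = j then T (G.voltage q.out) else 0) else 0 := by
  have hC : ∀ (n : ℤ) (m : ℤ), AddMonoidAlgebra.mapRingHom ℤ (Int.castRingHom (ZMod 2))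
      (C n * T m) = C (n : ZMod 2) * T m := by
    intro n m
    rw [← single_eq_C_mul_T, ← single_eq_C_mul_T, AddMonoidAlgebra.mapRingHom_single]
    rfl
  have hC0 : ∀ n : ℤ, AddMonoidAlgebra.mapRingHom ℤ (Int.castRingHom (ZMod 2))
      (C n) = C (n : ZMod 2) := by
    intro n
    have := hC n 0
    rwa [T_zero, T_zero, mul_one, mul_one] at this
  rw [laplacianModTwo, Matrix.map_apply, laplacian, Matrix.sub_apply, map_sub, ZModModule.sub_eq_add,
    adjacency, map_sum, Matrix.diagonal_apply]
  simp only [apply_ite (AddMonoidAlgebra.mapRingHom ℤ (Int.castRingHom (ZMod 2))), hC, hC0,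
    map_zero, intCast_units_zmod_two, map_one, one_mul, signedDegree, Int.cast_ite,
    Int.cast_zero, map_sum, apply_ite (C (R := ZMod 2))]
  rw [← Finset.sum_const_zero (s := (Finset.univ : Finset G.DartOrbit)), ← Finset.sum_ite_irrel,
    ← Finset.sum_add_distrib]
  refine Finset.sum_congr rfl fun q _ => ?_
  change _ + (if G.tailOrbit q = i ∧ G.headOrbit q = j then _ else _) = _
  change (if i = j then (if G.tailOrbit q = i then _ else _) else _) + _ = _
  by_cases h1 : G.tailOrbit q = i
  · by_cases h2 : i = j <;> by_cases h3 : G.headOrbit q = j <;> simp [h1, h2, h3]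
  · simp [h1]

theorem sum_translationAction_laplacianModTwo {A : Type*} [CommRing A]
    (b : G.VertexOrbit → A → ZMod 2) (i : G.VertexOrbit) (k : A) :
    (∑ j, translationAction A (G.laplacianModTwo i j) (b j)) k = G.laplaceOperator b i k := by
  classical
  simp only [laplacianModTwo_apply, map_sum, LinearMap.sum_apply, Finset.sum_apply]
  rw [Finset.sum_comm]
  refine Finset.sum_congr rfl fun q _ => ?_
  split_ifs with h
  · simp only [map_add, LinearMap.add_apply, Pi.add_apply, Finset.sum_add_distrib]
    congr 1
    · rw [Finset.sum_eq_single (G.tailOrbit q)] <;> simp +contextual [eq_comm]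
    · rw [Finset.sum_eq_single (G.headOrbit q)]
      · simp [translationAction_T]
      · intro j _ hj
        simp [hj.symm]
      · simp
  · simp

theorem mem_laplaceKernel_iff {A : Type*} [CommRing A] (b : G.VertexOrbit → A → ZMod 2) :
    b ∈ G.laplaceKernel A ↔
      ∀ i, ∑ j, translationAction A (G.laplacianModTwo i j) (b j) = 0 := by
  refine forall_congr' fun i => ?_
  rw [funext_iff]
  simp only [sum_translationAction_laplacianModTwo, Pi.zero_apply]

/-- Multiplying the system by the adjugate shows that the determinant, a nontrivial recurrence,
annihilates every coordinate of a solution. -/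
theorem finite_laplaceKernel
    (h : AddMonoidAlgebra.mapRingHom ℤ (Int.castRingHom (ZMod 2)) G.laplacianPolynomial ≠ 0) :
    (G.laplaceKernel ℤ).Finite := by
  classical
  rw [← det_laplacianModTwo] at h
  refine (Set.Finite.pi' fun _ : G.VertexOrbit => finite_translationAction_eq_zero h).subset ?_
  intro b hb l
  rw [mem_laplaceKernel_iff] at hb
  have h1 : ∑ i, translationAction ℤ (G.laplacianModTwo.adjugate l i)
      (∑ j, translationAction ℤ (G.laplacianModTwo i j) (b j)) = 0 := by
    simp [hb]
  simp only [map_sum] at h1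
  rw [Finset.sum_comm] at h1
  simp only [← Module.End.mul_apply, ← map_mul, ← LinearMap.sum_apply, ← map_sum,
    ← Matrix.mul_apply, Matrix.adjugate_mul] at h1
  rw [Finset.sum_eq_single l] at h1
  · simpa using h1
  · intro j _ hj
    simp [Matrix.one_apply_ne hj.symm]
  · simp

/-- Solutions on `ZMod N` are `N`-periodic solutions on `ℤ`, which gives a bound independent of `N`.
-/
theorem card_laplaceKernel_zmod_le (hfin : (G.laplaceKernel ℤ).Finite) (N : ℕ) :
    Nat.card (G.laplaceKernel (ZMod N)) ≤ Nat.card (G.laplaceKernel ℤ) := by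
  have : Finite (G.laplaceKernel ℤ) := hfin
  refine Nat.card_le_card_of_injective
    (fun b => ⟨fun i k => b.1 i (k : ZMod N), fun i k => ?_⟩) ?_
  · have := b.2 i (k : ZMod N)
    simp only [laplaceOperator] at this ⊢
    simpa using this
  · intro b c h
    refine Subtype.ext (funext fun i => funext fun k => ?_)
    obtain ⟨n, rfl⟩ := ZMod.intCast_surjective k
    exact congrFun (congrFun (congrArg Subtype.val h) i) n

/-- A singular matrix over a domain kills a nonzero vector `w`. The multiples `T t * w`, applied to
a point mass on `ZMod N`, are solutions, and for large `N` they differ pairwise in a coordinate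
where `w` is nonzero. -/
theorem exists_card_laplaceKernel_gt
    (h : AddMonoidAlgebra.mapRingHom ℤ (Int.castRingHom (ZMod 2)) G.laplacianPolynomial = 0)
    (B : ℕ) : ∃ N : ℕ, 0 < N ∧ B < Nat.card (G.laplaceKernel (ZMod N)) := by
  classical
  rw [← det_laplacianModTwo] at h
  obtain ⟨w, hw, hLw⟩ := Matrix.exists_mulVec_eq_zero_iff.2 h
  obtain ⟨j₀, hj₀⟩ := Function.ne_iff.1 hw
  have hT : ∀ t t' : Fin (B + 1), t ≠ t' →
      (T (t : ℤ) - T (t' : ℤ) : (ZMod 2)[T;T⁻¹]) * w j₀ ≠ 0 := by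
    intro t t' ht
    refine mul_ne_zero (sub_ne_zero.2 fun h => ht ?_) hj₀
    have h1 := congrArg (fun p : (ZMod 2)[T;T⁻¹] => p.coeff t) h
    simp only [T_apply, if_pos] at h1
    have : (t' : ℤ) = t := by
      by_contra hc
      simp [hc] at h1
    exact Fin.ext (by exact_mod_cast this.symm)
  have hev : ∀ᶠ N : ℕ in Filter.atTop, 0 < N ∧ ∀ t t' : Fin (B + 1), t ≠ t' →
      translationAction (ZMod N) ((T (t : ℤ) - T (t' : ℤ)) * w j₀)
        (Pi.single (0 : ZMod N) (1 : ZMod 2)) ≠ 0 := by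
    refine (Filter.eventually_gt_atTop 0).and ?_
    refine Filter.eventually_all.2 fun t => Filter.eventually_all.2 fun t' => ?_
    by_cases ht : t = t'
    · simp [ht]
    · filter_upwards [eventually_translationAction_single_ne_zero (hT t t' ht)] with N hN _
      exact hN
  obtain ⟨N, hN, hne⟩ := hev.exists
  refine ⟨N, hN, ?_⟩
  have : NeZero N := ⟨hN.ne'⟩
  let f : Fin (B + 1) → G.laplaceKernel (ZMod N) := fun t =>
    ⟨fun j => translationAction (ZMod N) (T (t : ℤ) * w j) (Pi.single (0 : ZMod N) (1 : ZMod 2)), by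
      rw [mem_laplaceKernel_iff]
      intro i
      simp only [← Module.End.mul_apply, ← map_mul, ← LinearMap.sum_apply, ← map_sum]
      have : ∑ j, G.laplacianModTwo i j * (T (t : ℤ) * w j) = 0 := by
        have h1 := congrFun hLw i
        simp only [Matrix.mulVec, dotProduct, Pi.zero_apply] at h1
        simp only [mul_left_comm _ (T (t : ℤ)), ← Finset.mul_sum, h1, mul_zero]
      rw [this, map_zero, LinearMap.zero_apply]⟩
  have hf : Function.Injective f := by
    intro t t' htt
    by_contra hcon
    refine hne t t' hcon ?_
    rw [sub_mul, map_sub, LinearMap.sub_apply]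
    exact sub_eq_zero.2 (congrFun (congrArg Subtype.val htt) j₀)
  have := Nat.card_le_card_of_injective f hf
  rw [Nat.card_fin] at this
  exact this

end PeriodicGraph

/-! ### Vertex functions of the cover as functions on darts. -/

namespace PeriodicGraph

variable {V D : Type*} (G : PeriodicGraph V D)

theorem tailOrbit_dartOrbit (d : D) : G.tailOrbit (G.dartOrbit d) = G.vertexOrbit (G.tail d) := by
  obtain ⟨n, hn⟩ := G.exists_zpow_out d
  conv_rhs => rw [← hn, tail_zpow, vertexOrbit_zpow]
  rfl

theorem headOrbit_dartOrbit (d : D) :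
    G.headOrbit (G.dartOrbit d) = G.vertexOrbit (G.tail (G.rev d)) := by
  obtain ⟨n, hn⟩ := G.exists_zpow_out d
  conv_rhs => rw [← hn, rev_zpow, tail_zpow, vertexOrbit_zpow]
  rfl

/-- A function on the vertices of the `N`-fold cyclic cover, as a function on the darts. -/
noncomputable def dartFunction {N : ℕ} (b : G.VertexOrbit → ZMod N → ZMod 2) :
    G.DartOrbit × ZMod N → ZMod 2 := fun x => b (G.tailOrbit x.1) x.2

theorem dartFunction_coverProj {N : ℕ} (b : G.VertexOrbit → ZMod N → ZMod 2) (d : D) :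
    G.dartFunction b (G.coverProj N d) = b (G.vertexOrbit (G.tail d)) (G.level (G.tail d)) := by
  rw [← tailOrbit_dartOrbit]
  rfl

theorem exists_dart_at (i : G.VertexOrbit) (n : ℤ) :
    ∃ d, G.vertexOrbit (G.tail d) = i ∧ G.level (G.tail d) = n := by
  obtain ⟨d, hd⟩ := G.no_isolated i.out
  refine ⟨(G.shiftD ^ (n - G.level (G.tail d))) d, ?_, ?_⟩
  · rw [tail_zpow, vertexOrbit_zpow, hd]
    exact Quotient.out_eq i
  · rw [tail_zpow, level_zpow, sub_add_cancel]

theorem dartFunction_injective (N : ℕ) :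
    Function.Injective (G.dartFunction (N := N)) := by
  intro b c h
  ext i k
  obtain ⟨n, rfl⟩ := ZMod.intCast_surjective k
  obtain ⟨d, rfl, rfl⟩ := G.exists_dart_at i n
  have := congrFun h (G.coverProj N d)
  rwa [dartFunction_coverProj, dartFunction_coverProj] at this

end PeriodicGraph

namespace PlanePeriodicGraph

variable {V D : Type*} (G : PlanePeriodicGraph V D)

theorem tail_rot (d : D) : G.tail (G.rot d) = G.tail d :=
  G.tail_eq_of_mem_closure_rot (Subgroup.subset_closure rfl) d

/-- Darts whose tails have the same orbit and congruent levels are related by a power of `shiftD ^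
N` and a power of `rot`. -/
theorem mem_invariantFunctions_coverRot_iff {N : ℕ} {w : G.DartOrbit × ZMod N → ZMod 2} :
    w ∈ invariantFunctions {G.coverRot N} ↔ ∃ b, G.dartFunction b = w := by
  rw [mem_invariantFunctions_singleton, (G.coverProj_surjective N).forall]
  simp only [coverRot_coverProj]
  constructor
  · intro hw
    have hrot : ∀ (j : ℤ) (d : D), w (G.coverProj N ((G.rot ^ j) d)) = w (G.coverProj N d) := by
      intro j d
      induction j with
      | zero => rfl
      | succ j ih => rw [add_comm, zpow_add, Equiv.Perm.mul_apply, zpow_one, hw, ih]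
      | pred j ih =>
        rw [← hw, ← Equiv.Perm.mul_apply, mul_self_zpow, sub_add_cancel, ih]
    choose! e he he' using G.exists_dart_at
    refine ⟨fun i k => w (G.coverProj N (e i k.cast)), funext fun x => ?_⟩
    obtain ⟨d, rfl⟩ := G.coverProj_surjective N x
    rw [G.dartFunction_coverProj]
    set n : ℤ := ((G.level (G.tail d) : ZMod N)).cast
    have hn : ((n : ℤ) : ZMod N) = (G.level (G.tail d) : ZMod N) := ZMod.intCast_zmod_cast _
    have h1 := Quotient.exact (he (G.vertexOrbit (G.tail d)) n)
    obtain ⟨m, hm⟩ := h1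
    rw [← G.tail_zpow] at hm
    obtain ⟨j, hj⟩ := (G.tail_eq_iff _ _).1 hm
    have h2 := hrot j ((G.shiftD ^ m) (e (G.vertexOrbit (G.tail d)) n))
    rw [hj] at h2
    have h3 : ((m : ℤ) : ZMod N) = 0 := by
      have h4 := congrArg (fun v => (G.level v : ZMod N)) hm
      simp only [G.tail_zpow, G.level_zpow, he', Int.cast_add, hn] at h4
      simpa using h4
    obtain ⟨k, rfl⟩ := (ZMod.intCast_zmod_eq_zero_iff_dvd m N).1 h3
    rw [h2]
    exact congrArg w ((G.coverProj_eq_iff N).2 ⟨k, rfl⟩).symm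
  · rintro ⟨b, rfl⟩ d
    rw [G.dartFunction_coverProj, G.dartFunction_coverProj, tail_rot]

/-- Grouping darts by their tails turns the weak harmonicity in `harmonicFunctions` into the Laplace
equation. -/
theorem sum_coboundary_dartFunction {N : ℕ} [NeZero N] (b c : G.VertexOrbit → ZMod N → ZMod 2) :
    ∑ x, coboundary (G.coverRev N) (G.dartFunction b) x * G.dartFunction c x =
      ∑ i, ∑ k, G.laplaceOperator b i k * c i k := by
  classical
  have h1 : ∀ x : G.DartOrbit × ZMod N, coboundary (G.coverRev N) (G.dartFunction b) x =
      b (G.tailOrbit x.1) x.2 + b (G.headOrbit x.1) (x.2 + (G.voltage x.1.out : ZMod N)) := by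
    intro x
    obtain ⟨d, rfl⟩ := G.coverProj_surjective N x
    rw [coboundary_apply, coverRev_coverProj, G.dartFunction_coverProj, G.dartFunction_coverProj]
    change _ = b (G.tailOrbit (G.dartOrbit d)) (G.level (G.tail d) : ZMod N) +
      b (G.headOrbit (G.dartOrbit d)) ((G.level (G.tail d) : ZMod N) +
        (G.voltage (G.dartOrbit d).out : ZMod N))
    rw [G.voltage_out, G.tailOrbit_dartOrbit, G.headOrbit_dartOrbit, PeriodicGraph.voltage]
    push_cast
    rw [add_sub_cancel]
  simp only [h1, PeriodicGraph.laplaceOperator, Finset.sum_mul, Fintype.sum_prod_type]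
  conv_rhs =>
    enter [2, i]
    rw [Finset.sum_comm]
  conv_rhs => rw [Finset.sum_comm]
  refine Finset.sum_congr rfl fun q _ => ?_
  rw [Finset.sum_eq_single (G.tailOrbit q)]
  · simp only [if_true]
    rfl
  · intro i _ hi
    simp [hi.symm]
  · simp

theorem card_harmonicFunctions_eq (N : ℕ) [NeZero N] :
    Nat.card (harmonicFunctions (G.coverRot N) (G.coverRev N)) =
      Nat.card (G.laplaceKernel (ZMod N)) := by
  classical
  have hmem : ∀ b : G.VertexOrbit → ZMod N → ZMod 2,
      G.dartFunction b ∈ harmonicFunctions (G.coverRot N) (G.coverRev N) ↔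
        b ∈ G.laplaceKernel (ZMod N) := by
    intro b
    constructor
    · rintro ⟨-, h⟩ i k
      -- Testing against a point mass isolates one value of the Laplacian.
      have h1 := h _ (G.mem_invariantFunctions_coverRot_iff.2 ⟨Pi.single i (Pi.single k 1), rfl⟩)
      rw [sum_coboundary_dartFunction, Finset.sum_eq_single i, Finset.sum_eq_single k] at h1
      · simpa using h1
      · intro l _ hl
        simp [hl]
      · simp
      · intro l _ hl
        simp [hl]
      · simp
    · intro hb
      refine ⟨G.mem_invariantFunctions_coverRot_iff.2 ⟨b, rfl⟩, fun w hw => ?_⟩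
      obtain ⟨c, rfl⟩ := G.mem_invariantFunctions_coverRot_iff.1 hw
      rw [sum_coboundary_dartFunction]
      refine Finset.sum_eq_zero fun i _ => Finset.sum_eq_zero fun k _ => ?_
      rw [hb i k, zero_mul]
  symm
  refine Nat.card_eq_of_bijective
    (fun b => ⟨G.dartFunction b.1, (hmem b.1).2 b.2⟩) ⟨?_, ?_⟩
  · intro b c h
    exact Subtype.ext (G.dartFunction_injective N (congrArg Subtype.val h))
  · rintro ⟨w, hw⟩
    obtain ⟨b, rfl⟩ := G.mem_invariantFunctions_coverRot_iff.1 hw.1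
    exact ⟨⟨b, (hmem b).1 hw⟩, rfl⟩

theorem card_medialColorings_eq_card_laplaceKernel (N : ℕ) [NeZero N] :
    Nat.card (medialColorings (G.coverRot N) (G.coverRev N)) =
      Nat.card (G.laplaceKernel (ZMod N)) :=
  (G.card_medialColorings_eq N).trans (G.card_harmonicFunctions_eq N)

end PlanePeriodicGraph

/-! ### 2-colorings and link components. -/

namespace LinkDiagram

variable {H : Type*} (L : LinkDiagram H)

theorem component_mate (h : H) : L.component (L.mate h) = L.component h :=
  (show L.component h = L.component (L.mate h) from Quot.sound (Or.inl rfl)).symm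

theorem component_next_next (h : H) : L.component (L.next (L.next h)) = L.component h :=
  (show L.component h = L.component (L.next (L.next h)) from Quot.sound (Or.inr rfl)).symm

theorem component_step (h : H) : L.component (L.step h) = L.component h := by
  rw [step, component_next_next, component_mate]

theorem component_iterate_step (n : ℕ) (h : H) :
    L.component (L.step^[n] h) = L.component h := by
  induction n with
  | zero => rfl
  | succ n ih => rw [Function.iterate_succ_apply', component_step, ih]

theorem step_injective : Function.Injective L.step :=
  (L.next.injective.comp L.next.injective).comp L.mate.injective

theorem finite_setOf_component_eq {h : H} {k : ℕ} (hk : 0 < k) (hh : L.step^[k] h = h) :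
    {x | L.component x = L.component h}.Finite := by
  let S : Set H := {x | ∃ i, x = L.step^[i] h ∨ x = L.mate (L.step^[i] h)}
  have hmate : ∀ x ∈ S, L.mate x ∈ S := by
    rintro x ⟨i, rfl | rfl⟩
    · exact ⟨i, Or.inr rfl⟩
    · exact ⟨i, Or.inl (L.mate_mate _)⟩
  have hopp : ∀ x ∈ S, L.next (L.next x) ∈ S := by
    rintro x ⟨i, rfl | rfl⟩
    · refine ⟨i + (k - 1), Or.inr ?_⟩
      have h1 : L.step^[i] h = L.step (L.step^[i + (k - 1)] h) := by
        rw [← Function.iterate_succ_apply' L.step, Nat.succ_eq_add_one,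
          show i + (k - 1) + 1 = i + k by omega, Function.iterate_add_apply, hh]
      rw [h1, step, L.next_four]
    · exact ⟨i + 1, Or.inl (Function.iterate_succ_apply' L.step i h).symm⟩
  have hmem : ∀ x, L.component x = L.component h → x ∈ S := by
    intro x hx
    let f : L.Component → Prop := Quot.lift (fun y => y ∈ S) (by
      rintro a b (rfl | rfl)
      · exact propext ⟨hmate a, fun h => by simpa [L.mate_mate] using hmate _ h⟩
      · exact propext ⟨hopp a, fun h => by simpa [L.next_four] using hopp _ h⟩)
    have h1 : f (L.component x) = f (L.component h) := congrArg f hx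
    exact h1.mpr ⟨0, Or.inl rfl⟩
  have hper : Function.IsPeriodicPt L.step k h := hh
  refine (((Set.finite_Iio k).image fun i => L.step^[i] h).union
    ((Set.finite_Iio k).image fun i => L.mate (L.step^[i] h))).subset fun x hx => ?_
  obtain ⟨i, hi⟩ := hmem x hx
  rw [← hper.iterate_mod_apply i] at hi
  exact hi.imp (fun hi => ⟨i % k, Nat.mod_lt _ hk, hi.symm⟩)
    (fun hi => ⟨i % k, Nat.mod_lt _ hk, hi.symm⟩)

/-- A function on the half-edges that is constant along the components defines a 2-coloring. -/
def coloringOfInvariant (f : H → ZMod 2) (hmate : ∀ h, f (L.mate h) = f h)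
    (hopp : ∀ h, f (L.next (L.next h)) = f h) : L.colorings (ZMod 2) :=
  ⟨Quot.lift f (by
      rintro a b (rfl | ⟨-, rfl⟩)
      · exact (hmate a).symm
      · exact (hopp a).symm), by
    intro h _
    change 2 • f h = f (L.next h) + f (L.next.symm h)
    have : L.next (L.next (L.next h)) = L.next.symm h := by
      rw [Equiv.eq_symm_apply, L.next_four]
    rw [← this, hopp, CharTwo.add_self_eq_zero, two_smul, CharTwo.add_self_eq_zero]⟩

/-- In characteristic 2 the overcrossing term drops out, so colors also continue through
undercrossings. -/
theorem coloring_next_next (c : L.colorings (ZMod 2)) (h : H) :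
    c.1 (L.arc (L.next (L.next h))) = c.1 (L.arc h) := by
  by_cases ho : L.isOver h
  · have h1 : L.arc h = L.arc (L.next (L.next h)) := Quot.sound (Or.inr ⟨ho, rfl⟩)
    rw [h1]
  · have h1 : L.isOver (L.next h) := (L.isOver_next h).2 ho
    have h2 := c.2 _ h1
    rw [two_smul, CharTwo.add_self_eq_zero, Equiv.symm_apply_apply, eq_comm,
      CharTwo.add_eq_zero] at h2
    exact h2

theorem coloring_eq_of_component_eq (c : L.colorings (ZMod 2)) {h h' : H}
    (hh : L.component h = L.component h') : c.1 (L.arc h) = c.1 (L.arc h') := by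
  let f : L.Component → ZMod 2 := Quot.lift (fun h => c.1 (L.arc h)) (by
    rintro a b (rfl | rfl)
    · exact congrArg c.1 (Quot.sound (Or.inl rfl))
    · exact (L.coloring_next_next c a).symm)
  exact congrArg f hh

theorem finite_colorings_of_finite_component [Finite L.Component] :
    Finite (L.colorings (ZMod 2)) := by
  refine Finite.of_injective (β := L.Component → ZMod 2)
    (fun c K => c.1 (L.arc (Quot.out K))) fun c c' h => Subtype.ext (funext ?_)
  rintro ⟨x⟩
  have h1 : L.component (Quot.out (L.component x)) = L.component x := Quot.out_eq _
  have h2 := congrFun h (L.component x)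
  simp only [L.coloring_eq_of_component_eq _ h1] at h2
  exact h2

end LinkDiagram

/-! ### Components and colorings of the medial diagram under translation. -/

namespace PlanePeriodicGraph

variable {V D : Type*} (G : PlanePeriodicGraph V D)

/-- The translation of the half-edges of the medial diagram. -/
def shiftHalf (n : ℤ) (h : D × Bool) : D × Bool := ((G.shiftD ^ n) h.1, h.2)

theorem shiftHalf_add (m n : ℤ) (h : D × Bool) :
    G.shiftHalf (m + n) h = G.shiftHalf m (G.shiftHalf n h) := by
  rw [shiftHalf, zpow_add]
  rfl

theorem medialDiagram_next_next (h : D × Bool) :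
    G.medialDiagram.next (G.medialDiagram.next h) = (G.rev h.1, h.2) := by
  rcases h with ⟨d, _ | _⟩ <;> simp [medialDiagram]

theorem medialDiagram_mate_true (d : D) : G.medialDiagram.mate (d, true) = (G.rot d, false) := rfl

theorem medialDiagram_mate_false (d : D) :
    G.medialDiagram.mate (d, false) = (G.rot.symm d, true) := rfl

theorem rot_symm_zpow (n : ℤ) (d : D) :
    G.rot.symm ((G.shiftD ^ n) d) = (G.shiftD ^ n) (G.rot.symm d) :=
  Equiv.Perm.zpow_apply_comm_of_commute G.commute_rot_shiftD.inv_left n d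

theorem mate_shiftHalf (n : ℤ) (h : D × Bool) :
    G.medialDiagram.mate (G.shiftHalf n h) = G.shiftHalf n (G.medialDiagram.mate h) := by
  rcases h with ⟨d, _ | _⟩
  · simp only [shiftHalf, medialDiagram_mate_false, rot_symm_zpow]
  · simp only [shiftHalf, medialDiagram_mate_true, rot_zpow]

theorem next_next_shiftHalf (n : ℤ) (h : D × Bool) :
    G.medialDiagram.next (G.medialDiagram.next (G.shiftHalf n h)) =
      G.shiftHalf n (G.medialDiagram.next (G.medialDiagram.next h)) := by
  simp only [medialDiagram_next_next, shiftHalf, G.rev_zpow]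

theorem step_shiftHalf (n : ℤ) : Function.Commute G.medialDiagram.step (G.shiftHalf n) := by
  intro h
  rw [LinkDiagram.step, LinkDiagram.step, mate_shiftHalf, next_next_shiftHalf]

theorem component_shiftHalf (n : ℤ) {h h' : D × Bool}
    (hh : G.medialDiagram.component h = G.medialDiagram.component h') :
    G.medialDiagram.component (G.shiftHalf n h) = G.medialDiagram.component (G.shiftHalf n h') := by
  let f : G.medialDiagram.Component → G.medialDiagram.Component :=
    Quot.map (G.shiftHalf n) (by
      rintro a b (rfl | rfl)
      · exact Or.inl (G.mate_shiftHalf n a).symm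
      · exact Or.inr (G.next_next_shiftHalf n a).symm)
  exact congrArg f hh

theorem component_rev (d : D) (b : Bool) :
    G.medialDiagram.component (G.rev d, b) = G.medialDiagram.component (d, b) := by
  rw [← G.medialDiagram.component_next_next (d, b), medialDiagram_next_next]

theorem component_rot_symm (d : D) :
    G.medialDiagram.component (G.rot.symm d, true) = G.medialDiagram.component (d, false) := by
  rw [← G.medialDiagram.component_mate (d, false), medialDiagram_mate_false]

/-- By pigeonhole the journey from `h` meets two half-edges that differ by a translation. A trivial
translation would close the component; a nontrivial one can be pulled back to `h`. -/
theorem exists_shift_component_eq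
    (hopen : ¬ ∃ K : G.medialDiagram.Component, K.IsClosed) (h : D × Bool) :
    ∃ n : ℕ, 0 < n ∧
      G.medialDiagram.component (G.shiftHalf n h) = G.medialDiagram.component h := by
  have key : ∀ i j : ℕ, i < j →
      G.dartOrbit (G.medialDiagram.step^[i] h).1 = G.dartOrbit (G.medialDiagram.step^[j] h).1 →
      (G.medialDiagram.step^[i] h).2 = (G.medialDiagram.step^[j] h).2 →
      ∃ n : ℕ, 0 < n ∧
        G.medialDiagram.component (G.shiftHalf n h) = G.medialDiagram.component h := by
    intro i j hij h1 h2
    obtain ⟨n, hn⟩ := Quotient.exact h1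
    have h3 : G.shiftHalf n (G.medialDiagram.step^[i] h) = G.medialDiagram.step^[j] h :=
      Prod.ext hn h2
    rw [← ((G.step_shiftHalf n).iterate_left i).eq, show j = i + (j - i) by omega,
      Function.iterate_add_apply] at h3
    have h4 := G.medialDiagram.step_injective.iterate i h3
    have h5 : G.medialDiagram.component (G.shiftHalf n h) = G.medialDiagram.component h := by
      rw [h4, LinkDiagram.component_iterate_step]
    rcases lt_trichotomy n 0 with hn | rfl | hn
    · refine ⟨(-n).toNat, by omega, ?_⟩
      have h6 := G.component_shiftHalf (-n) h5
      rw [← shiftHalf_add, neg_add_cancel] at h6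
      rw [Int.toNat_of_nonneg (by omega), ← h6]
      rfl
    · exact absurd ⟨_, h, rfl, j - i, by omega, h4.symm⟩ hopen
    · refine ⟨n.toNat, by omega, ?_⟩
      rwa [Int.toNat_of_nonneg hn.le]
  obtain ⟨i, j, hne, heq⟩ := Finite.exists_ne_map_eq_of_infinite fun i : ℕ =>
    (G.dartOrbit (G.medialDiagram.step^[i] h).1, (G.medialDiagram.step^[i] h).2)
  rcases lt_or_gt_of_ne hne with hlt | hlt
  · exact key i j hlt (Prod.ext_iff.1 heq).1 (Prod.ext_iff.1 heq).2
  · exact key j i hlt (Prod.ext_iff.1 heq).1.symm (Prod.ext_iff.1 heq).2.symm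

/-- On each orbit of half-edges, the component depends only on the translation modulo the period
found in `exists_shift_component_eq`. -/
theorem finite_component (hopen : ¬ ∃ K : G.medialDiagram.Component, K.IsClosed) :
    Finite G.medialDiagram.Component := by
  choose n hn hcomp using G.exists_shift_component_eq hopen
  refine Finite.of_surjective
    (α := Σ p : G.DartOrbit × Bool, Fin (n (p.1.out, p.2)))
    (fun x => G.medialDiagram.component (G.shiftHalf x.2.1 (x.1.1.out, x.1.2))) ?_
  rintro ⟨⟨d, b⟩⟩
  obtain ⟨m, hm⟩ := G.exists_zpow_out d
  set h : D × Bool := ((G.dartOrbit d).out, b)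
  have hmul : ∀ k : ℤ, G.medialDiagram.component (G.shiftHalf (n h * k) h) =
      G.medialDiagram.component h := by
    intro k
    induction k with
    | zero => simp [shiftHalf]
    | succ k ih =>
      rw [mul_add, mul_one, add_comm, shiftHalf_add, G.component_shiftHalf _ ih, hcomp]
    | pred k ih =>
      have h1 := G.component_shiftHalf ((n h : ℤ) * (-k - 1)) (hcomp h)
      rw [← h1, ← shiftHalf_add, ← ih]
      ring_nf
  have hpos : (0 : ℤ) < n h := by exact_mod_cast hn h
  have hnonneg := Int.emod_nonneg m hpos.ne'
  have hlt := Int.emod_lt_of_pos m hpos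
  have hlt' : (m % n h).toNat < n h := by omega
  refine ⟨⟨(G.dartOrbit d, b), ⟨(m % n h).toNat, hlt'⟩⟩, ?_⟩
  change G.medialDiagram.component (G.shiftHalf ((m % n h).toNat : ℤ) h) =
    G.medialDiagram.component (d, b)
  have h1 := G.component_shiftHalf (m % n h) (hmul (m / n h))
  rw [← shiftHalf_add, Int.emod_add_mul_ediv] at h1
  rw [Int.toNat_of_nonneg hnonneg, ← h1]
  exact congrArg (fun x => G.medialDiagram.component (x, b)) hm

theorem card_medialColorings_le (N : ℕ) [Finite (G.medialDiagram.colorings (ZMod 2))] :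
    Nat.card (medialColorings (G.coverRot N) (G.coverRev N)) ≤
      Nat.card (G.medialDiagram.colorings (ZMod 2)) := by
  refine Nat.card_le_card_of_injective (fun c => G.medialDiagram.coloringOfInvariant
    (fun h => if h.2 then c.1 (G.coverProj N h.1) else c.1 (G.coverProj N (G.rot.symm h.1)))
    ?_ ?_) ?_
  · rintro ⟨d, _ | _⟩
    · rw [medialDiagram_mate_false]
      rfl
    · rw [medialDiagram_mate_true]
      simp
  · rintro ⟨d, _ | _⟩
    · rw [medialDiagram_next_next]
      have := c.2.2 (G.coverProj N d)
      rwa [coverRev_coverProj, coverRot_symm_coverProj, coverRot_symm_coverProj] at this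
    · rw [medialDiagram_next_next]
      have := c.2.1 (G.coverProj N d)
      rwa [coverRev_coverProj] at this
  · intro c c' h
    refine Subtype.ext (funext fun x => ?_)
    obtain ⟨d, rfl⟩ := G.coverProj_surjective N x
    exact congrFun (congrArg Subtype.val h) (G.medialDiagram.arc (d, true))

/-- Otherwise the component would contain infinitely many translates of one half-edge. -/
theorem eq_zero_of_component_shift_eq {d : D}
    (hfin : {x | G.medialDiagram.component x = G.medialDiagram.component (d, true)}.Finite) {n : ℤ}
    (hn : G.medialDiagram.component (G.shiftHalf n (d, true)) =
      G.medialDiagram.component (d, true)) : n = 0 := by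
  by_contra hne
  refine Set.infinite_of_injective_forall_mem
    (f := fun j : ℕ => G.shiftHalf (n * j) (d, true)) ?_ (fun j => ?_) hfin
  · intro i j hij
    have h1 : (G.shiftD ^ (n * i)) d = (G.shiftD ^ (n * j)) d := congrArg Prod.fst hij
    have h2 : (G.shiftD ^ (-(n * j) + n * i)) d = d := by
      rw [zpow_add, Equiv.Perm.mul_apply, h1, ← Equiv.Perm.mul_apply, ← zpow_add]
      simp
    have h3 := G.eq_zero_of_shiftD_zpow_eq h2
    have h4 : n * ((i : ℤ) - j) = 0 := by linarith
    have := (mul_eq_zero.1 h4).resolve_left hne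
    omega
  · change G.medialDiagram.component _ = _
    induction j with
    | zero => simp [shiftHalf]
    | succ j ih =>
      rw [Nat.cast_succ, mul_add, mul_one, add_comm, shiftHalf_add, G.component_shiftHalf _ ih, hn]

/-- The colorings are the indicators of the images in the cover of `N` successive translates of the
closed component. -/
theorem le_card_medialColorings {K : G.medialDiagram.Component} (hK : K.IsClosed) (N : ℕ)
    [NeZero N] : N ≤ Nat.card (medialColorings (G.coverRot N) (G.coverRev N)) := by
  classical
  obtain ⟨h, hhK, k, hk, hh⟩ := hK
  -- Every edge of the medial diagram joins a left half-edge to a right one.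
  obtain ⟨d, hd⟩ : ∃ d, G.medialDiagram.component (d, true) = K := by
    rcases h with ⟨d, _ | _⟩
    · exact ⟨G.rot.symm d, by rw [component_rot_symm, hhK]⟩
    · exact ⟨d, hhK⟩
  have hfin := G.medialDiagram.finite_setOf_component_eq hk hh
  rw [hhK, ← hd] at hfin
  let P : ℤ → G.DartOrbit × ZMod N → Prop := fun t x =>
    ∃ e, G.coverProj N e = x ∧ G.medialDiagram.component (G.shiftHalf t (e, true)) = K
  have hrev : ∀ t x, P t x → P t (G.coverRev N x) := by
    rintro t _ ⟨e, rfl, he⟩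
    refine ⟨G.rev e, by simp, ?_⟩
    rw [G.component_shiftHalf t (G.component_rev e true), he]
  have hrot : ∀ t x, P t ((G.coverRot N).symm x) →
      P t ((G.coverRot N).symm (G.coverRev N x)) := by
    rintro t x ⟨e, hx, he⟩
    rw [Equiv.eq_symm_apply, coverRot_coverProj] at hx
    refine ⟨G.rot.symm (G.rev (G.rot e)), by simp [← hx], ?_⟩
    rw [G.component_shiftHalf t (G.component_rot_symm _),
      G.component_shiftHalf t (G.component_rev _ _),
      ← G.component_shiftHalf t (G.component_rot_symm _), Equiv.symm_apply_apply, he]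
  let c : Fin N → medialColorings (G.coverRot N) (G.coverRev N) := fun t =>
    ⟨fun x => if P t x then 1 else 0, by
      refine ⟨fun x => ?_, fun x => ?_⟩
      · refine if_congr ⟨fun h => ?_, hrev _ _⟩ rfl rfl
        simpa [coverRev_coverRev] using hrev _ _ h
      · refine if_congr ⟨fun h => ?_, hrot _ _⟩ rfl rfl
        simpa [coverRev_coverRev] using hrot _ _ h⟩
  have hc : Function.Injective c := by
    intro t t' htt
    have h1 := congrFun (congrArg Subtype.val htt) (G.coverProj N ((G.shiftD ^ (-(t : ℤ))) d))
    have h2 : P t (G.coverProj N ((G.shiftD ^ (-(t : ℤ))) d)) := by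
      refine ⟨_, rfl, ?_⟩
      rw [← hd, ← show G.shiftHalf 0 (d, true) = (d, true) from rfl,
        ← add_neg_cancel (t : ℤ), shiftHalf_add]
      rfl
    have h3 : P t' (G.coverProj N ((G.shiftD ^ (-(t : ℤ))) d)) := by
      by_contra hcon
      change (if P t _ then (1 : ZMod 2) else 0) = if P t' _ then 1 else 0 at h1
      rw [if_pos h2, if_neg hcon] at h1
      exact one_ne_zero h1
    obtain ⟨e, he, heK⟩ := h3
    obtain ⟨m, rfl⟩ := (G.coverProj_eq_iff N).1 he
    -- If two indicators agree, this translation preserves the finite component and is trivial, so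
    -- `t` and `t'` are congruent modulo `N`.
    have h4 : G.medialDiagram.component (G.shiftHalf (t' + (N * m + -t)) (d, true)) =
        G.medialDiagram.component (d, true) := by
      rw [shiftHalf_add, shiftHalf_add, hd]
      exact heK
    have h5 := G.eq_zero_of_component_shift_eq hfin h4
    have h6 : (t : ℤ) - t' = 0 :=
      Int.eq_zero_of_abs_lt_dvd (m := N) ⟨m, by linarith⟩ (by
        have := t.2
        have := t'.2
        rw [abs_lt]
        omega)
    exact Fin.ext (by omega)
  simpa using Nat.card_le_card_of_injective c hc

end PlanePeriodicGraph

/-! ### The three implications. -/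

theorem mainTheorem10 {V D : Type*} (G : PlanePeriodicGraph V D) :
    List.TFAE [
      ∃ K : G.medialDiagram.Component, K.IsClosed,
      Infinite (G.medialDiagram.colorings (ZMod 2)),
      AddMonoidAlgebra.mapRingHom ℤ (Int.castRingHom (ZMod 2)) G.laplacianPolynomial = 0] := by
  tfae_have 1 → 3 := by
    rintro ⟨K, hK⟩
    by_contra h
    have hfin := G.finite_laplaceKernel h
    -- One more than the uniform bound on the kernels is already too many colorings.
    have h1 := G.le_card_medialColorings hK (Nat.card (G.laplaceKernel ℤ) + 1)
    rw [G.card_medialColorings_eq_card_laplaceKernel] at h1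
    have h2 := G.card_laplaceKernel_zmod_le hfin (Nat.card (G.laplaceKernel ℤ) + 1)
    omega
  tfae_have 3 → 2 := by
    intro h
    by_contra hinf
    rw [not_infinite_iff_finite] at hinf
    obtain ⟨N, hN, hlt⟩ := G.exists_card_laplaceKernel_gt h
      (Nat.card (G.medialDiagram.colorings (ZMod 2)))
    have : NeZero N := ⟨hN.ne'⟩
    rw [← G.card_medialColorings_eq_card_laplaceKernel] at hlt
    exact absurd (G.card_medialColorings_le N) (not_le.2 hlt)
  tfae_have 2 → 1 := by
    intro hinf
    by_contra hopen
    have := G.finite_component hopen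
    exact not_finite_iff_infinite.2 hinf G.medialDiagram.finite_colorings_of_finite_component
  tfae_finish
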